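/- Let $n\ge 2$ be an integer and let $W:\mathbb{R}\to\mathbb{R}$ satisfy: (W1) $W$ is continuous and $W\ge 0$; (W2) $W(t)=0$ if and only if $t=\pm1$; (W3) there is $L>0$ such that $W(t)\ge L(t\mp1)^2$ for all $\pm t>0$. Let $\lambda_n=\lambda_n(W)$ be the optimal (that is, largest) constant such that $$\lambda_n\int_J (u^{(n-1)})^2\,dx\le \frac{1}{|J|^{2n-2}}\int_J W(u)\,dx+|J|^2\int_J (u^{(n)})^2\,dx$$ for every open bounded interval $J\subset\mathbb{R}$ and every $u\in W^{n,2}(J)$, where $u^{(j)}$ denotes the $j$-th weak derivative and $|J|$ the length of $J$. Let $\lambda\in(0,\lambda_n)$, let $I\subset\mathbb{R}$ be a non-empty open bounded interval, and for $\varepsilon>0$ and $u\in W^{n,2}(I)$ put $$G_\varepsilon^{\lambda,n}[u]=\int_I \frac1\varepsilon W(u)-\lambda\varepsilon^{2n-3}(u^{(n-1)})^2+\varepsilon^{2n-1}(u^{(n)})^2\,dx .$$ Let $\varepsilon_m>0$ with $\varepsilon_m\to0$ as $m\to\infty$, and let $u_m\in W^{n,2}(I)$ be such that $\limsup_{m\to\infty}G_{\varepsilon_m}^{\lambda,n}[u_m]<\infty$.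 Then there exist a subsequence $(u_{m_k})_k$ and a function $u\in BV(I,\{\pm1\})$ such that $u_{m_k}\to u$ in $L^1(I)$ as $k\to\infty$. Here $u\in BV(I,\{\pm1\})$ means that $u\in L^1(I)$, that $u\in\{-1,1\}$ almost everywhere in $I$, and that $\sup\{\int_I u\varphi'\,dx:\varphi\in C_c^\infty(I),\ \|\varphi\|_{L^\infty(I)}\le1\}<\infty$. -/

import Mathlib

open MeasureTheory Filter Topology Set
open scoped ContDiff ENNReal

namespace HigherOrderPhase

/-- Test functions on `I`: smooth functions on the line with compact support contained in `I`. -/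
def IsTestFun (I : Set ℝ) (φ : ℝ → ℝ) : Prop :=
  ContDiff ℝ ∞ φ ∧ HasCompactSupport φ ∧ tsupport φ ⊆ I

/-- `g` is a `k`-th weak derivative of `u` on `I`. -/
def IsWeakDeriv (I : Set ℝ) (k : ℕ) (u g : ℝ → ℝ) : Prop :=
  LocallyIntegrableOn u I ∧ LocallyIntegrableOn g I ∧
    ∀ φ : ℝ → ℝ, IsTestFun I φ →
      ∫ x in I, u x * iteratedDeriv k φ x = (-1) ^ k * ∫ x in I, g x * φ x

open Classical in
/-- The `k`-th weak derivative of `u` on `I` (on an open `I` it is unique up to null sets);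
it is `0` by convention if no weak derivative exists. -/
noncomputable def weakDeriv (I : Set ℝ) (k : ℕ) (u : ℝ → ℝ) : ℝ → ℝ :=
  if h : ∃ g, IsWeakDeriv I k u g then h.choose else 0

/-- `u ∈ W^{n,2}(I)`: the weak derivatives of all orders `0, …, n` exist and lie in `L²(I)`. -/
def MemSobolev (I : Set ℝ) (n : ℕ) (u : ℝ → ℝ) : Prop :=
  MemLp u 2 (volume.restrict I) ∧
    ∀ j ≤ n, ∃ g, IsWeakDeriv I j u g ∧ MemLp g 2 (volume.restrict I)

/-- The variation `V[u] = sup { ∫_I u φ' : φ ∈ C_c^∞(I), ‖φ‖_∞ ≤ 1 }`. -/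
noncomputable def variation (I : Set ℝ) (u : ℝ → ℝ) : EReal :=
  ⨆ φ ∈ {φ : ℝ → ℝ | IsTestFun I φ ∧ ∀ x, |φ x| ≤ 1},
    ((∫ x in I, u x * deriv φ x : ℝ) : EReal)

/-- `u ∈ BV(I, {±1})`. -/
def MemBVSign (I : Set ℝ) (u : ℝ → ℝ) : Prop :=
  MemLp u 1 (volume.restrict I) ∧
    (∀ᵐ x ∂(volume.restrict I), u x = 1 ∨ u x = -1) ∧ variation I u < ⊤

/-- The assumptions on the double-well potential: continuity and non-negativity, zeros exactly at
`±1`, and quadratic coercivity. -/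
structure IsDoubleWell (W : ℝ → ℝ) : Prop where
  continuous : Continuous W
  nonneg : ∀ t, 0 ≤ W t
  eq_zero_iff : ∀ t, W t = 0 ↔ t = 1 ∨ t = -1
  coercive : ∃ L > 0, (∀ t > 0, L * (t - 1) ^ 2 ≤ W t) ∧ (∀ t < 0, L * (t + 1) ^ 2 ≤ W t)

open Classical in
/-- The energy `G_ε^{lam,n}[u]` on `I`, with value `+∞` outside `W^{n,2}(I)`. -/
noncomputable def energy (W : ℝ → ℝ) (I : Set ℝ) (n : ℕ) (lam ε : ℝ) (u : ℝ → ℝ) : EReal :=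
  if MemSobolev I n u then
    ((∫ x in I, (1 / ε * W (u x) - lam * ε ^ (2 * n - 3) * (weakDeriv I (n - 1) u x) ^ 2
      + ε ^ (2 * n - 1) * (weakDeriv I n u x) ^ 2) : ℝ) : EReal)
  else ⊤

/-- The constants `c` that are admissible in the nonlinear interpolation inequality
`c ∫_I (u^{(n-1)})² ≤ |I|^{-(2n-2)} ∫_I W(u) + |I|² ∫_I (u^{(n)})²`,
for all open bounded intervals `I` and all `u ∈ W^{n,2}(I)`. -/
def interpolationConstants (W : ℝ → ℝ) (n : ℕ) : Set ℝ :=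
  {c | ∀ a b : ℝ, a < b → ∀ u : ℝ → ℝ, MemSobolev (Ioo a b) n u →
    c * ∫ x in Ioo a b, (weakDeriv (Ioo a b) (n - 1) u x) ^ 2 ≤
      1 / (b - a) ^ (2 * n - 2) * (∫ x in Ioo a b, W (u x))
        + (b - a) ^ 2 * ∫ x in Ioo a b, (weakDeriv (Ioo a b) n u x) ^ 2}

/-- The critical parameter `lam_n`: the optimal (largest) constant in the interpolation inequality.
For `n ≥ 1` and a continuous `W ≥ 0`, the set of admissible constants contains `0` and is bounded
above, as one sees by inserting `u x = x ^ (n - 1)`, so that the supremum is a genuine one. -/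
noncomputable def criticalParameter (W : ℝ → ℝ) (n : ℕ) : ℝ :=
  sSup (interpolationConstants W n)

end HigherOrderPhase

/-! The negative term is absorbed on a grid of scale `ε`. Choose an admissible constant `c > lam`
and cut `(a, b)` into equal cells of width `h ≤ ε` with `ε / h → 1`. The interpolation inequality,
summed over the cells, bounds the negative term by `(lam / c) * (ε / h) ^ (2n - 2)` times the
remaining energy. This factor is eventually below some `κ < 1`, so the potential and the
highest-order terms are bounded by themselves (`positiveEnergy_le`).

Next comes rigidity at scale `ε` (`exists_rigidity`). On a window of two adjacent cells with little
energy, `u` is close to a polynomial of bounded degree. This polynomial is near `±1` at many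
separated points, hence near a single sign at enough of them, and Lagrange interpolation keeps it
near that sign throughout.

A bounded energy leaves boundedly many bad windows, and good windows that overlap carry the same
sign. So `u` is `L¹`-close to a step function with boundedly many jumps (`exists_stepSigns_near`):
`∫ ||u| - 1|` is of order `√ε` by coercivity and Cauchy–Schwarz, and the bad cells add a term of
order `ε`. Such step functions are sequentially compact (`stepSigns.exists_subseq`), and the limit
is again one of them, hence in `BV`. -/

namespace HigherOrderPhase

/-! ### Weak derivatives and test functions on an interval. -/

section WeakDerivatives

variable {a b c d : ℝ} {φ ψ u g g' : ℝ → ℝ} {k n : ℕ} {I J : Set ℝ}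

lemma IsTestFun.continuous (h : IsTestFun I φ) : Continuous φ := h.1.continuous

lemma IsTestFun.mono (hIJ : I ⊆ J) (h : IsTestFun I φ) : IsTestFun J φ :=
  ⟨h.1, h.2.1, h.2.2.trans hIJ⟩

lemma IsTestFun.eq_zero (h : IsTestFun I φ) {x : ℝ} (hx : x ∉ I) : φ x = 0 :=
  image_eq_zero_of_notMem_tsupport fun h' => hx (h.2.2 h')

lemma IsTestFun.deriv (h : IsTestFun I φ) : IsTestFun I (deriv φ) :=
  ⟨(contDiff_infty_iff_deriv.1 h.1).2, h.2.1.deriv, tsupport_deriv_subset.trans h.2.2⟩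

lemma IsTestFun.iteratedDeriv (h : IsTestFun I φ) : ∀ k, IsTestFun I (iteratedDeriv k φ)
  | 0 => by simpa using h
  | k + 1 => by rw [iteratedDeriv_succ]; exact (h.iteratedDeriv k).deriv

lemma IsTestFun.exists_Icc (hab : a < b) (h : IsTestFun (Ioo a b) φ) :
    ∃ c d, a < c ∧ c ≤ d ∧ d < b ∧ ∀ x ∉ Icc c d, φ x = 0 := by
  rcases (tsupport φ).eq_empty_or_nonempty with h0 | h0
  · refine ⟨(a + b) / 2, (a + b) / 2, by linarith, le_rfl, by linarith, fun x _ => ?_⟩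
    exact image_eq_zero_of_notMem_tsupport (by simp [h0])
  · have hK : IsCompact (tsupport φ) := h.2.1
    have h1 := h.2.2 (hK.sInf_mem h0)
    have h2 := h.2.2 (hK.sSup_mem h0)
    refine ⟨sInf (tsupport φ), sSup (tsupport φ), h1.1, ?_, h2.2, fun x hx => ?_⟩
    · exact csInf_le hK.bddBelow (hK.sSup_mem h0)
    · refine image_eq_zero_of_notMem_tsupport fun h' => hx ⟨?_, ?_⟩
      · exact csInf_le hK.bddBelow h'
      · exact le_csSup hK.bddAbove h'

lemma setIntegral_mul_test (h : IsTestFun (Ioo a b) φ) (g : ℝ → ℝ) (hJ : Ioo a b ⊆ J)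
    (hJm : MeasurableSet J) :
    ∫ x in J, g x * φ x = ∫ x in Ioo a b, g x * φ x :=
  (setIntegral_eq_of_subset_of_forall_sdiff_eq_zero hJm hJ
    fun x hx => by rw [h.eq_zero hx.2, mul_zero])

lemma integrableOn_mul_test (hab : a < b) (hg : LocallyIntegrableOn g (Ioo a b))
    (h : IsTestFun (Ioo a b) φ) : IntegrableOn (fun x => g x * φ x) (Ioo a b) := by
  obtain ⟨c, d, hac, hcd, hdb, h0⟩ := h.exists_Icc hab
  have h1 : IntegrableOn g (Icc c d) :=
    hg.integrableOn_compact_subset (Icc_subset_Ioo hac hdb) isCompact_Icc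
  have h2 : IntegrableOn (fun x => g x * φ x) (Icc c d) :=
    h1.mul_continuousOn h.continuous.continuousOn isCompact_Icc
  refine IntegrableOn.of_forall_sdiff_eq_zero h2 measurableSet_Ioo fun x hx => ?_
  rw [h0 x hx.2, mul_zero]

/-- The fundamental lemma of the calculus of variations. It makes the representative chosen in
`weakDeriv` irrelevant. -/
lemma IsWeakDeriv.unique (hab : a < b) (h : IsWeakDeriv (Ioo a b) k u g)
    (h' : IsWeakDeriv (Ioo a b) k u g') : g =ᵐ[volume.restrict (Ioo a b)] g' := by
  have key := isOpen_Ioo.ae_eq_zero_of_integral_contDiff_smul_eq_zero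
    (h.2.1.sub h'.2.1) (μ := volume) (U := Ioo a b) fun φ h1 h2 h3 => by
      have hφ : IsTestFun (Ioo a b) φ := ⟨h1, h2, h3⟩
      have e1 := h.2.2 φ hφ
      have e2 := h'.2.2 φ hφ
      have e3 : ∫ x in Ioo a b, g x * φ x = ∫ x in Ioo a b, g' x * φ x := by
        rw [e1] at e2
        exact mul_left_cancel₀ (pow_ne_zero k (by norm_num)) e2
      have e4 : ∫ x in Ioo a b, (g x - g' x) * φ x = 0 := by
        simp_rw [sub_mul]
        rw [integral_sub (integrableOn_mul_test hab h.2.1 hφ)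
          (integrableOn_mul_test hab h'.2.1 hφ), e3, sub_self]
      rw [← setIntegral_univ, ← e4, ← setIntegral_mul_test hφ _ (subset_univ _) .univ]
      simp [mul_comm]
  rw [EventuallyEq, ae_restrict_iff' measurableSet_Ioo]
  filter_upwards [key] with x hx hxI
  exact sub_eq_zero.1 (hx hxI)

lemma IsWeakDeriv.mono (hcd : Ioo c d ⊆ Ioo a b) (h : IsWeakDeriv (Ioo a b) k u g) :
    IsWeakDeriv (Ioo c d) k u g := by
  refine ⟨h.1.mono_set hcd, h.2.1.mono_set hcd, fun φ hφ => ?_⟩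
  have := h.2.2 φ (hφ.mono hcd)
  rwa [setIntegral_mul_test (hφ.iteratedDeriv k) _ hcd measurableSet_Ioo,
    setIntegral_mul_test hφ _ hcd measurableSet_Ioo] at this

lemma MemSobolev.mono (hcd : Ioo c d ⊆ Ioo a b) (h : MemSobolev (Ioo a b) n u) :
    MemSobolev (Ioo c d) n u := by
  refine ⟨h.1.mono_measure (Measure.restrict_mono hcd le_rfl), fun j hj => ?_⟩
  obtain ⟨g, h1, h2⟩ := h.2 j hj
  exact ⟨g, h1.mono hcd, h2.mono_measure (Measure.restrict_mono hcd le_rfl)⟩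

lemma MemSobolev.isWeakDeriv (h : MemSobolev I n u) (hk : k ≤ n) :
    IsWeakDeriv I k u (weakDeriv I k u) := by
  obtain ⟨g, hg, -⟩ := h.2 k hk
  have hex : ∃ g, IsWeakDeriv I k u g := ⟨g, hg⟩
  rw [weakDeriv, dif_pos hex]
  exact hex.choose_spec

lemma MemSobolev.memLp_weakDeriv (hab : a < b) (h : MemSobolev (Ioo a b) n u) (hk : k ≤ n) :
    MemLp (weakDeriv (Ioo a b) k u) 2 (volume.restrict (Ioo a b)) := by
  obtain ⟨g, hg, hg2⟩ := h.2 k hk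
  exact hg2.ae_eq (hg.unique hab (h.isWeakDeriv hk))

/-- The two sides are independent choices; their agreement lets inequalities on cells be summed to
one on the whole interval. -/
lemma MemSobolev.weakDeriv_ae_eq (hcd : c < d) (hs : Ioo c d ⊆ Ioo a b)
    (h : MemSobolev (Ioo a b) n u) (hk : k ≤ n) :
    weakDeriv (Ioo c d) k u =ᵐ[volume.restrict (Ioo c d)] weakDeriv (Ioo a b) k u :=
  ((h.mono hs).isWeakDeriv hk).unique hcd ((h.isWeakDeriv hk).mono hs)

lemma exists_test_integral_eq_one (hab : a < b) :
    ∃ η, IsTestFun (Ioo a b) η ∧ ∫ x in Ioo a b, η x = 1 := by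
  have hm : (a + b) / 2 ∈ Ioo a b := ⟨by linarith, by linarith⟩
  obtain ⟨f, h1, h2, h3, h4, h5⟩ :=
    exists_contDiff_tsupport_subset (n := ⊤) (isOpen_Ioo.mem_nhds hm)
  have hf : IsTestFun (Ioo a b) f := ⟨h3, h2, h1⟩
  have h0 : ∀ x, 0 ≤ f x := fun x => (h4 ⟨x, rfl⟩).1
  have e : ∫ x in Ioo a b, f x = ∫ x, f x :=
    setIntegral_eq_integral_of_forall_compl_eq_zero fun x hx => hf.eq_zero hx
  have hpos : 0 < ∫ x in Ioo a b, f x := by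
    rw [e]
    exact hf.continuous.integral_pos_of_hasCompactSupport_nonneg_nonzero h2 h0
      (x := (a + b) / 2) (by rw [h5]; norm_num)
  refine ⟨fun x => (∫ x in Ioo a b, f x)⁻¹ * f x, ⟨contDiff_const.mul h3, ?_, ?_⟩, ?_⟩
  · exact h2.mul_left
  · exact (closure_mono (Function.support_mul_subset_right _ _)).trans h1
  · rw [integral_const_mul, inv_mul_cancel₀ hpos.ne']

lemma setIntegral_Ioo_eq_intervalIntegral (hab : a ≤ b) (f : ℝ → ℝ) :
    ∫ x in Ioo a b, f x = ∫ x in a..b, f x := by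
  rw [intervalIntegral.integral_of_le hab, integral_Ioc_eq_integral_Ioo]

/-- The primitive from `a` vanishes left of the support of `ψ`, and right of it because the mean of
`ψ` is zero. -/
lemma exists_test_antideriv (hab : a < b) (hψ : IsTestFun (Ioo a b) ψ)
    (h0 : ∫ x in Ioo a b, ψ x = 0) :
    ∃ φ, IsTestFun (Ioo a b) φ ∧ deriv φ = ψ := by
  obtain ⟨c, d, hac, hcd, hdb, hz⟩ := hψ.exists_Icc hab
  rw [setIntegral_Ioo_eq_intervalIntegral hab.le] at h0
  have hd : ∀ x, HasDerivAt (fun x => ∫ t in a..x, ψ t) (ψ x) x := fun x =>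
    hψ.continuous.integral_hasStrictDerivAt a x |>.hasDerivAt
  have hd' : deriv (fun x => ∫ t in a..x, ψ t) = ψ := funext fun x => (hd x).deriv
  have hi : ∀ p q, IntervalIntegrable ψ volume p q := fun p q => hψ.continuous.intervalIntegrable _ _
  have hz' : ∀ x ∉ Icc c d, ∫ t in a..x, ψ t = 0 := by
    intro x hx
    rcases lt_or_ge x c with hxc | hxc
    · apply intervalIntegral.integral_zero_ae
      refine ae_of_all _ fun t ht => hz t fun ht' => ?_
      rcases le_total a x with h | h
      · rw [uIoc_of_le h] at ht; linarith [ht.2, ht'.1]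
      · rw [uIoc_of_ge h] at ht; linarith [ht.2, ht'.1]
    · have hxd : d < x := by by_contra h; exact hx ⟨hxc, not_lt.1 h⟩
      rw [← intervalIntegral.integral_add_adjacent_intervals (hi a b) (hi b x), h0, zero_add]
      apply intervalIntegral.integral_zero_ae
      refine ae_of_all _ fun t ht => hz t fun ht' => ?_
      rcases le_total b x with h | h
      · rw [uIoc_of_le h] at ht; linarith [ht.1, ht'.2]
      · rw [uIoc_of_ge h] at ht; linarith [ht.1, ht'.2]
  have hts : tsupport (fun x => ∫ t in a..x, ψ t) ⊆ Icc c d := by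
    refine closure_minimal (fun x hx => ?_) isClosed_Icc
    by_contra h
    exact hx (hz' x h)
  refine ⟨fun x => ∫ t in a..x, ψ t, ⟨?_, ?_, hts.trans (Icc_subset_Ioo hac hdb)⟩, hd'⟩
  · rw [contDiff_infty_iff_deriv, hd']
    exact ⟨fun x => (hd x).differentiableAt, hψ.1⟩
  · exact isCompact_Icc.of_isClosed_subset (isClosed_tsupport _) hts

/-- Integration by parts of a primitive against the derivative of a test function. -/
lemma integral_primitive_mul_deriv (hab : a < b) (hg : IntegrableOn g (Ioo a b))
    (hφ : IsTestFun (Ioo a b) φ) :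
    ∫ x in Ioo a b, (∫ t in a..x, g t) * deriv φ x = -∫ x in Ioo a b, g x * φ x := by
  have hgi : IntervalIntegrable g volume a b := by
    rwa [intervalIntegrable_iff_integrableOn_Ioo_of_le hab.le]
  -- As `g` is merely integrable, its primitive is only absolutely continuous, which suffices to
  -- integrate by parts.
  have h1 := hgi.absolutelyContinuousOnInterval_intervalIntegral (c := a) (by simp)
  have h2 : AbsolutelyContinuousOnInterval φ a b :=
    ContDiffOn.absolutelyContinuousOnInterval (hφ.1.of_le (by simp)).contDiffOn
  rw [setIntegral_Ioo_eq_intervalIntegral hab.le, setIntegral_Ioo_eq_intervalIntegral hab.le,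
    h1.integral_mul_deriv_eq_deriv_mul h2, hφ.eq_zero (x := a) (by simp),
    hφ.eq_zero (x := b) (by simp)]
  simp only [mul_zero, sub_self, zero_sub, neg_inj]
  apply intervalIntegral.integral_congr_ae
  filter_upwards [hgi.ae_hasDerivAt_integral] with x hx hxI
  rw [(hx (uIoc_subset_uIcc hxI) a (by simp)).deriv]

end WeakDerivatives

/-! ### Functions with a weak derivative as perturbed polynomials. -/

section Representation

variable {a b : ℝ} {u g : ℝ → ℝ} {k n : ℕ}

open Polynomial in
lemma isWeakDeriv_polynomial (hab : a < b) (k : ℕ) (p : ℝ[X]) :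
    IsWeakDeriv (Ioo a b) k (fun x => p.eval x) (fun x => (derivative^[k] p).eval x) := by
  refine ⟨p.continuous.locallyIntegrable.locallyIntegrableOn _,
    (Polynomial.continuous _).locallyIntegrable.locallyIntegrableOn _, ?_⟩
  induction k generalizing p with
  | zero => intro φ _; simp
  | succ k ih =>
    intro φ hφ
    have h := hφ.iteratedDeriv k
    rw [iteratedDeriv_succ, Function.iterate_succ_apply, pow_succ, mul_assoc, neg_one_mul,
      mul_neg, ← ih (derivative p) φ hφ, setIntegral_Ioo_eq_intervalIntegral hab.le,
      setIntegral_Ioo_eq_intervalIntegral hab.le,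
      intervalIntegral.integral_mul_deriv_eq_deriv_mul (fun x _ => p.hasDerivAt x)
        (fun x _ => ((h.1.differentiable (by simp)) x).hasDerivAt)
        ((Polynomial.continuous _).intervalIntegrable _ _)
        (h.deriv.continuous.intervalIntegrable _ _),
      h.eq_zero (x := a) (by simp), h.eq_zero (x := b) (by simp)]
    simp

lemma IsWeakDeriv.sub (hab : a < b) {v h : ℝ → ℝ} (hu : IsWeakDeriv (Ioo a b) k u g)
    (hv : IsWeakDeriv (Ioo a b) k v h) :
    IsWeakDeriv (Ioo a b) k (fun x => u x - v x) (fun x => g x - h x) := by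
  refine ⟨hu.1.sub hv.1, hu.2.1.sub hv.2.1, fun φ hφ => ?_⟩
  simp_rw [sub_mul]
  rw [integral_sub (integrableOn_mul_test hab hu.1 (hφ.iteratedDeriv k))
      (integrableOn_mul_test hab hv.1 (hφ.iteratedDeriv k)),
    integral_sub (integrableOn_mul_test hab hu.2.1 hφ) (integrableOn_mul_test hab hv.2.1 hφ),
    hu.2.2 φ hφ, hv.2.2 φ hφ, mul_sub]

lemma integrableOn_primitive (hab : a < b) (hg : IntegrableOn g (Ioo a b)) :
    IntegrableOn (fun x => ∫ t in a..x, g t) (Ioo a b) := by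
  have hgi : IntegrableOn g (Icc a b) := by rwa [integrableOn_Icc_iff_integrableOn_Ioo]
  exact ((intervalIntegral.continuousOn_primitive_interval
    (by rwa [uIcc_of_le hab.le])).integrableOn_compact
      isCompact_uIcc).mono_set (by rw [uIcc_of_le hab.le]; exact Ioo_subset_Icc_self)

/-- A function with a weak derivative of order `n + 1` has one of order `n`, which is a primitive
of the former. -/
lemma IsWeakDeriv.exists_primitive (hab : a < b) (hg : IntegrableOn g (Ioo a b))
    (h : IsWeakDeriv (Ioo a b) (n + 1) u g) :
    ∃ c, IsWeakDeriv (Ioo a b) n u (fun x => (∫ t in a..x, g t) + c) := by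
  obtain ⟨η, hη, hη1⟩ := exists_test_integral_eq_one hab
  set G : ℝ → ℝ := fun x => ∫ t in a..x, g t with hG
  have hGi : IntegrableOn G (Ioo a b) := integrableOn_primitive hab hg
  set K := ∫ x in Ioo a b, u x * iteratedDeriv n η x with hK
  -- The constant is forced by testing with `η`, whose integral is `1`.
  refine ⟨(-1) ^ n * K - ∫ x in Ioo a b, G x * η x, h.1,
    (hGi.add (integrableOn_const (by simp))).locallyIntegrableOn, fun ψ hψ => ?_⟩
  set C := ∫ x in Ioo a b, ψ x with hC
  have hψi : ∀ {f}, IsTestFun (Ioo a b) f → IntegrableOn f (Ioo a b) := fun hf =>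
    (hf.continuous.integrable_of_hasCompactSupport hf.2.1).integrableOn
  -- Removing the mean of `ψ` leaves the derivative of a test function `φ`, to which the weak
  -- derivative of order `n + 1` applies.
  have hts : IsTestFun (Ioo a b) (fun x => ψ x - C * η x) := by
    refine ⟨hψ.1.sub (contDiff_const.mul hη.1), hψ.2.1.sub hη.2.1.mul_left, ?_⟩
    refine (tsupport_sub ψ (fun x => C * η x)).trans (union_subset hψ.2.2 ?_)
    exact (closure_mono (Function.support_mul_subset_right _ _)).trans hη.2.2
  obtain ⟨φ, hφ, hφd⟩ := exists_test_antideriv hab hts (by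
    rw [integral_sub (hψi hψ) ((hψi hη).const_mul C), integral_const_mul, hη1, ← hC]; ring)
  have e1 := h.2.2 φ hφ
  have e2 := integral_primitive_mul_deriv hab hg hφ
  have hid : ∀ x, iteratedDeriv (n + 1) φ x = iteratedDeriv n ψ x - C * iteratedDeriv n η x := by
    intro x
    rw [iteratedDeriv_succ', hφd, iteratedDeriv_fun_sub, iteratedDeriv_const_mul_field]
    · exact (hψ.1.of_le (by exact_mod_cast le_top)).contDiffAt
    · exact (contDiff_const.mul (hη.1.of_le (by exact_mod_cast le_top))).contDiffAt
  simp_rw [hid, mul_sub] at e1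
  rw [hφd] at e2
  simp_rw [mul_sub] at e2
  have c1 : ∀ x, u x * (C * iteratedDeriv n η x) = C * (u x * iteratedDeriv n η x) := fun x => by
    ring
  have c2 : ∀ x, G x * (C * η x) = C * (G x * η x) := fun x => by ring
  simp_rw [c1] at e1
  change ∫ x in Ioo a b, (G x * ψ x - G x * (C * η x)) = _ at e2
  simp_rw [c2] at e2
  have iη := integrableOn_mul_test hab h.1 (hη.iteratedDeriv n)
  have iψ := integrableOn_mul_test hab h.1 (hψ.iteratedDeriv n)
  have jη := integrableOn_mul_test hab hGi.locallyIntegrableOn hη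
  have jψ := integrableOn_mul_test hab hGi.locallyIntegrableOn hψ
  rw [integral_sub iψ (iη.const_mul C), integral_const_mul, ← hK] at e1
  rw [integral_sub jψ (jη.const_mul C), integral_const_mul] at e2
  simp_rw [add_mul]
  rw [integral_add jψ ((hψi hψ).const_mul _), integral_const_mul, ← hC]
  have hs : ((-1 : ℝ) ^ n) * (-1) ^ n = 1 := by rw [← mul_pow]; norm_num
  rw [pow_succ] at e1
  linear_combination e1 - (-1 : ℝ) ^ n * e2 - C * K * hs

lemma integral_abs_primitive_le (hab : a < b) (hg : IntegrableOn g (Ioo a b)) :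
    ∫ x in Ioo a b, |∫ t in a..x, g t| ≤ (b - a) * ∫ x in Ioo a b, |g x| := by
  have hb : ∀ x ∈ Ioo a b, |∫ t in a..x, g t| ≤ ∫ x in Ioo a b, |g x| := by
    intro x hx
    refine (intervalIntegral.abs_integral_le_integral_abs hx.1.le).trans ?_
    rw [← setIntegral_Ioo_eq_intervalIntegral hx.1.le]
    exact setIntegral_mono_set hg.abs (ae_of_all _ fun _ => abs_nonneg _)
      (Ioo_subset_Ioo_right hx.2.le).eventuallyLE
  calc ∫ x in Ioo a b, |∫ t in a..x, g t| ≤ ∫ x in Ioo a b, (∫ x in Ioo a b, |g x|) :=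
        setIntegral_mono_on (integrableOn_primitive hab hg).abs (integrableOn_const (by simp))
          measurableSet_Ioo hb
    _ = _ := by simp [hab.le]

open Polynomial in
/-- A function with an integrable weak derivative of order `n + 1` is a polynomial of degree at most
`n` up to an error controlled by that derivative. -/
lemma IsWeakDeriv.exists_polynomial (hab : a < b) (hg : IntegrableOn g (Ioo a b))
    (h : IsWeakDeriv (Ioo a b) (n + 1) u g) :
    ∃ p : ℝ[X], p.natDegree ≤ n ∧
      ∀ᵐ x ∂(volume.restrict (Ioo a b)), |u x - p.eval x| ≤ (b - a) ^ n * ∫ t in Ioo a b, |g t| := by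
  induction n generalizing u g with
  | zero =>
    obtain ⟨c, hc⟩ := h.exists_primitive hab hg
    have h0 : IsWeakDeriv (Ioo a b) 0 u u := ⟨h.1, h.1, fun φ _ => by simp⟩
    refine ⟨C c, by simp, ?_⟩
    filter_upwards [h0.unique hab hc, ae_restrict_mem measurableSet_Ioo] with x hx hxI
    rw [hx, eval_C, add_sub_cancel_right, pow_zero, one_mul]
    refine (intervalIntegral.abs_integral_le_integral_abs hxI.1.le).trans ?_
    rw [← setIntegral_Ioo_eq_intervalIntegral hxI.1.le]
    exact setIntegral_mono_set hg.abs (ae_of_all _ fun _ => abs_nonneg _)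
      (Ioo_subset_Ioo_right hxI.2.le).eventuallyLE
  | succ n ih =>
    obtain ⟨c, hc⟩ := h.exists_primitive hab hg
    -- Subtracting `q` cancels the integration constant `c`, so that `u - q` has the bare primitive
    -- of `g` as its derivative of order `n + 1`.
    set q : ℝ[X] := C (c / (n + 1).factorial) * X ^ (n + 1) with hq
    have hqd : derivative^[n + 1] q = C c := by
      rw [hq, iterate_derivative_C_mul, iterate_derivative_X_pow_eq_natCast_mul,
        Nat.descFactorial_self, Nat.sub_self, pow_zero, mul_one, ← C_eq_natCast, ← C_mul,
        div_mul_cancel₀]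
      exact_mod_cast Nat.factorial_ne_zero _
    have hw := hc.sub hab (isWeakDeriv_polynomial hab (n + 1) q)
    simp only [hqd, eval_C, add_sub_cancel_right] at hw
    obtain ⟨p, hp, hpb⟩ := ih (integrableOn_primitive hab hg) hw
    refine ⟨p + q, ?_, ?_⟩
    · refine (natDegree_add_le _ _).trans (max_le (hp.trans n.le_succ) ?_)
      exact natDegree_C_mul_X_pow_le _ _
    · filter_upwards [hpb] with x hx
      rw [eval_add]
      calc |u x - (p.eval x + q.eval x)| = |u x - q.eval x - p.eval x| := by congr 1; ring
        _ ≤ _ := hx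
        _ ≤ (b - a) ^ n * ((b - a) * ∫ t in Ioo a b, |g t|) := by
          exact mul_le_mul_of_nonneg_left (integral_abs_primitive_le hab hg)
            (pow_nonneg (by linarith) n)
        _ = _ := by ring

end Representation

/-! ### Rigidity on an interval of small rescaled energy. -/

section LocalRigidity

variable {a b : ℝ} {n : ℕ}

open Polynomial in
/-- A polynomial that is small on a finite family of separated nodes is small. -/
lemma abs_eval_le_of_nodes {A : Finset ℕ} {p : ℝ[X]} {y : ℕ → ℝ} {τ η M x : ℝ}
    (hA : A.card = n + 1) (hp : p.natDegree ≤ n) (hτ : 0 < τ) (hη : 0 ≤ η)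
    (hsep : ∀ i ∈ A, ∀ j ∈ A, i ≠ j → τ ≤ |y i - y j|) (hx : ∀ i ∈ A, |x - y i| ≤ M * τ)
    (hpy : ∀ i ∈ A, |p.eval (y i)| ≤ η) :
    |p.eval x| ≤ (n + 1) * (η * M ^ n) := by
  have hinj : Set.InjOn y A := by
    intro i hi j hj hij
    by_contra hne
    have := hsep i hi j hj hne
    rw [hij, sub_self, abs_zero] at this
    linarith
  have hdeg : p.degree < (A.card : ℕ) := by
    rw [hA]
    exact lt_of_le_of_lt degree_le_natDegree (by exact_mod_cast Nat.lt_succ_of_le hp)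
  rw [Lagrange.eq_interpolate hinj hdeg, Lagrange.interpolate_apply, eval_finsetSum]
  refine (Finset.abs_sum_le_sum_abs _ _).trans ?_
  -- A basis polynomial is a product of `n` quotients `|x - y j| / |y i - y j|`, each at most `M`.
  have hterm : ∀ i ∈ A, |eval x (C (p.eval (y i)) * Lagrange.basis A y i)| ≤ η * M ^ n := by
    intro i hi
    rw [eval_mul, eval_C, abs_mul]
    refine mul_le_mul (hpy i hi) ?_ (abs_nonneg _) hη
    rw [Lagrange.basis, eval_prod, Finset.abs_prod]
    have hc : (A.erase i).card = n := by rw [Finset.card_erase_of_mem hi, hA]; rfl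
    rw [← hc]
    refine (Finset.prod_le_prod (fun _ _ => abs_nonneg _) fun j hj => ?_).trans_eq
      (Finset.prod_const M)
    obtain ⟨hji, hj⟩ := Finset.mem_erase.1 hj
    have h1 := hsep i hi j hj hji.symm
    have h2 := hx j hj
    simp only [Lagrange.basisDivisor, eval_mul, eval_C, eval_sub, eval_X, abs_mul, abs_inv]
    rw [inv_mul_le_iff₀ (hτ.trans_le h1), mul_comm]
    have hM : 0 ≤ M := by
      by_contra hM
      have := (abs_nonneg _).trans h2
      nlinarith
    exact h2.trans (mul_le_mul_of_nonneg_left h1 hM)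
  refine (Finset.sum_le_sum hterm).trans ?_
  rw [Finset.sum_const, hA, nsmul_eq_mul]
  push_cast
  exact le_rfl

/-- Cauchy–Schwarz, read off from the non-negativity of the variance of `|f|`; `m` is the mean. -/
lemma sq_integral_abs_le {f : ℝ → ℝ} (hab : a < b) (hf : MemLp f 2 (volume.restrict (Ioo a b))) :
    (∫ x in Ioo a b, |f x|) ^ 2 ≤ (b - a) * ∫ x in Ioo a b, f x ^ 2 := by
  have hi : IntegrableOn f (Ioo a b) := hf.integrable (by norm_num)
  have hi2 : IntegrableOn (fun x => f x ^ 2) (Ioo a b) := hf.integrable_sq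
  set S := ∫ x in Ioo a b, |f x|
  set m := S / (b - a) with hm
  have hba : 0 < b - a := sub_pos.2 hab
  have h0 : 0 ≤ ∫ x in Ioo a b, (|f x| - m) ^ 2 := integral_nonneg fun x => sq_nonneg _
  have h1 : ∀ x, (|f x| - m) ^ 2 = f x ^ 2 - (2 * m * |f x| - m ^ 2) := fun x => by
    rw [sub_sq, sq_abs]; ring
  have i1 : IntegrableOn (fun x => 2 * m * |f x|) (Ioo a b) := hi.abs.const_mul _
  have i2 : IntegrableOn (fun _ : ℝ => m ^ 2) (Ioo a b) := integrableOn_const (by simp)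
  have i3 : IntegrableOn (fun x => 2 * m * |f x| - m ^ 2) (Ioo a b) := i1.sub i2
  simp_rw [h1] at h0
  rw [integral_sub hi2 i3, integral_sub i1 i2, integral_const_mul] at h0
  simp only [integral_const, MeasurableSet.univ, measureReal_restrict_apply, univ_inter,
    Real.volume_real_Ioo_of_le hab.le, smul_eq_mul] at h0
  have hmS : m * (b - a) = S := div_mul_cancel₀ _ hba.ne'
  change 0 ≤ _ - (2 * m * S - _) at h0
  nlinarith

lemma exists_mem_Ioo_mul_le_integral {f : ℝ → ℝ} {P : ℝ → Prop} (hab : a < b)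
    (hf : IntegrableOn f (Ioo a b)) (hP : ∀ᵐ x ∂(volume.restrict (Ioo a b)), P x) :
    ∃ y ∈ Ioo a b, P y ∧ (b - a) * f y ≤ ∫ x in Ioo a b, f x := by
  have hba : 0 < b - a := sub_pos.2 hab
  have hμ : volume.restrict (Ioo a b) ≠ 0 := by
    rw [Ne, Measure.restrict_eq_zero, Real.volume_Ioo]
    simpa using hab
  obtain ⟨y, hy, hy'⟩ := exists_notMem_null_le_average hμ hf
    (ae_iff.1 (hP.and (ae_restrict_mem measurableSet_Ioo)))
  simp only [mem_ofPred_eq, not_not] at hy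
  refine ⟨y, hy.2, hy.1, ?_⟩
  rw [setAverage_eq, Real.volume_real_Ioo_of_le hab.le, smul_eq_mul] at hy'
  calc (b - a) * f y ≤ (b - a) * ((b - a)⁻¹ * ∫ x in Ioo a b, f x) := by gcongr
    _ = _ := by field_simp

/-- The sign is coded as a `Bool` to serve as a label in the pigeonhole argument of
`exists_rigidity`. -/
lemma exists_sign_abs_sub_le {t η : ℝ} (h : |(|t| - 1)| ≤ η) :
    ∃ s : Bool, |t - (if s then 1 else -1)| ≤ η := by
  rcases le_total 0 t with h0 | h0
  · exact ⟨true, by simpa [abs_of_nonneg h0] using h⟩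
  · refine ⟨false, ?_⟩
    rw [abs_of_nonpos h0] at h
    rw [← abs_neg]
    convert h using 2
    simp only [Bool.false_eq_true, if_false]
    ring

/-- A function with small rescaled energy on an interval stays close to one of the two wells. -/
lemma exists_rigidity (n : ℕ) : ∃ δ > 0, ∀ (c d : ℝ) (u g : ℝ → ℝ), c < d →
    IsWeakDeriv (Ioo c d) (n + 1) u g → MemLp g 2 (volume.restrict (Ioo c d)) →
    IntegrableOn (fun x => (|u x| - 1) ^ 2) (Ioo c d) →
    ∫ x in Ioo c d, (|u x| - 1) ^ 2 ≤ (d - c) * δ →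
    (d - c) ^ (2 * n + 1) * ∫ x in Ioo c d, g x ^ 2 ≤ δ →
    ∃ s : ℝ, (s = 1 ∨ s = -1) ∧ ∀ᵐ x ∂(volume.restrict (Ioo c d)), |u x - s| ≤ 1 / 2 := by
  -- `D` is the interpolation constant of `abs_eval_le_of_nodes` for `M = 4 * N`. The final error is
  -- at most `ρ + 2 * D * ρ ≤ 1/6 + 1/3`. The factor `4 * N` in `δ` pays for averaging over a slot
  -- of length `(d - c) / (4 * N)`.
  set N : ℝ := (n : ℝ) + 1 with hN
  have hN1 : 1 ≤ N := by rw [hN]; linarith [(Nat.cast_nonneg n : (0 : ℝ) ≤ n)]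
  set D : ℝ := N * (4 * N) ^ n with hD
  have hD1 : 1 ≤ D := one_le_mul_of_one_le_of_one_le hN1 (one_le_pow₀ (by linarith))
  set ρ : ℝ := 1 / (6 * D) with hρ
  have hρ0 : 0 < ρ := by positivity
  have hρD : D * ρ = 1 / 6 := by rw [hρ]; field_simp
  refine ⟨ρ ^ 2 / (4 * N), by positivity, fun c d u g hcd hw hg hui hu hgb => ?_⟩
  have hl : 0 < d - c := sub_pos.2 hcd
  set l := d - c with hldef
  obtain ⟨p, hp, hpu⟩ := hw.exists_polynomial hcd (hg.integrable (by norm_num))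
  set R := l ^ n * ∫ t in Ioo c d, |g t| with hR
  have hR0 : 0 ≤ R := mul_nonneg (by positivity) (integral_nonneg fun _ => abs_nonneg _)
  have hRρ : R ≤ ρ := by
    refine abs_le_of_sq_le_sq' ?_ hρ0.le |>.2
    calc R ^ 2 = (l ^ n) ^ 2 * (∫ t in Ioo c d, |g t|) ^ 2 := by rw [hR, mul_pow]
      _ ≤ (l ^ n) ^ 2 * (l * ∫ x in Ioo c d, g x ^ 2) := by
        gcongr; exact sq_integral_abs_le hcd hg
      _ = l ^ (2 * n + 1) * ∫ x in Ioo c d, g x ^ 2 := by ring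
      _ ≤ ρ ^ 2 / (4 * N) := hgb
      _ ≤ ρ ^ 2 := div_le_self (by positivity) (by linarith)
  -- There are `2 * N` slots of length `τ`, each followed by a gap of length `τ`; the gaps separate
  -- the nodes.
  set τ := l / (4 * N) with hτ
  have hτ0 : 0 < τ := by positivity
  have hτl : 4 * N * τ = l := by rw [hτ]; field_simp
  have hsub : ∀ j < 2 * (n + 1), Ioo (c + 2 * j * τ) (c + (2 * j + 1) * τ) ⊆ Ioo c d := by
    intro j hj
    have hj' : (j : ℝ) + 1 ≤ 2 * N := by rw [hN]; exact_mod_cast hj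
    refine Ioo_subset_Ioo ?_ ?_
    · have : 0 ≤ 2 * (j : ℝ) * τ := by positivity
      linarith
    · have : (2 * (j : ℝ) + 1) * τ ≤ 4 * N * τ := by gcongr; linarith
      linarith
  have hnode : ∀ j : ℕ, ∃ y : ℝ, j < 2 * (n + 1) →
      y ∈ Ioo (c + 2 * j * τ) (c + (2 * j + 1) * τ) ∧
        ∃ s : Bool, |p.eval y - (if s then 1 else -1)| ≤ 2 * ρ := by
    intro j
    by_cases hj : j < 2 * (n + 1)
    swap
    · exact ⟨0, fun h => absurd h hj⟩
    have hjs := hsub j hj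
    obtain ⟨y, hy, hyP, hyi⟩ := exists_mem_Ioo_mul_le_integral (by linarith)
      (hui.mono_set hjs) (ae_restrict_of_ae_restrict_of_subset hjs hpu)
    refine ⟨y, fun _ => ⟨hy, exists_sign_abs_sub_le ?_⟩⟩
    have h1 : τ * (|u y| - 1) ^ 2 ≤ l * (ρ ^ 2 / (4 * N)) := by
      calc τ * (|u y| - 1) ^ 2 = (c + (2 * j + 1) * τ - (c + 2 * j * τ)) * (|u y| - 1) ^ 2 := by
            ring
        _ ≤ _ := hyi
        _ ≤ ∫ x in Ioo c d, (|u x| - 1) ^ 2 :=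
          setIntegral_mono_set hui (ae_of_all _ fun _ => sq_nonneg _) hjs.eventuallyLE
        _ ≤ _ := hu
    have h2 : (|u y| - 1) ^ 2 ≤ ρ ^ 2 := by
      have : l * (ρ ^ 2 / (4 * N)) = τ * ρ ^ 2 := by rw [hτ]; ring
      rw [this] at h1
      exact le_of_mul_le_mul_left h1 hτ0
    have h3 : |(|u y| - 1)| ≤ ρ := abs_le_of_sq_le_sq h2 hρ0.le
    have h4 : |(|p.eval y| - |u y|)| ≤ R := (abs_abs_sub_abs_le _ _).trans (by
      rw [abs_sub_comm]; exact hyP)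
    calc |(|p.eval y| - 1)| = |(|p.eval y| - |u y|) + (|u y| - 1)| := by congr 1; ring
      _ ≤ R + ρ := (abs_add_le _ _).trans (add_le_add h4 h3)
      _ ≤ 2 * ρ := by linarith
  choose y hy using hnode
  choose! s hs using fun j hj => (hy j hj).2
  -- Of `2 * (n + 1)` nodes, `n + 1` share a sign: as many as determine a polynomial of degree at
  -- most `n`.
  obtain ⟨σ, -, hσ⟩ := Finset.exists_le_card_fiber_of_mul_le_card_of_maps_to
    (s := Finset.range (2 * (n + 1))) (t := (Finset.univ : Finset Bool)) (f := s) (n := n + 1)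
    (fun _ _ => Finset.mem_univ _) Finset.univ_nonempty (by simp)
  obtain ⟨A, hAs, hA⟩ := Finset.exists_subset_card_eq hσ
  have hAr : ∀ i ∈ A, i < 2 * (n + 1) ∧ s i = σ := fun i hi => by
    simpa using hAs hi
  refine ⟨if σ then 1 else -1, by cases σ <;> simp, ?_⟩
  filter_upwards [hpu, ae_restrict_mem measurableSet_Ioo] with x hx hxI
  have hlt : ∀ i ∈ A, ∀ j ∈ A, i < j → τ ≤ |y i - y j| := by
    intro i hi j hj hij
    have h1 := (hy i (hAr i hi).1).1
    have h2 := (hy j (hAr j hj).1).1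
    have hij' : (i : ℝ) + 1 ≤ j := by exact_mod_cast hij
    have h3 : ((i : ℝ) + 1) * τ ≤ j * τ := by gcongr
    rw [abs_sub_comm]
    refine le_trans ?_ (le_abs_self _)
    nlinarith [h1.2, h2.1]
  have hpoly := abs_eval_le_of_nodes (x := x) (M := 4 * N) (η := 2 * ρ) (τ := τ) (y := y)
    (p := p - Polynomial.C (if σ then 1 else -1)) hA
    ((Polynomial.natDegree_sub_C (a := if σ then (1 : ℝ) else -1)).trans_le hp) hτ0 (by positivity)
    (fun i hi j hj hij => by
      rcases lt_or_gt_of_ne hij with h | h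
      · exact hlt i hi j hj h
      · rw [abs_sub_comm]; exact hlt j hj i hi h)
    (fun i hi => by
      have h1 := hsub i (hAr i hi).1 (hy i (hAr i hi).1).1
      rw [hτl, abs_le]
      constructor <;> linarith [h1.1, h1.2, hxI.1, hxI.2])
    (fun i hi => by
      have := hs i (hAr i hi).1
      rw [(hAr i hi).2] at this
      simpa using this)
  rw [Polynomial.eval_sub, Polynomial.eval_C] at hpoly
  have hfin : ((n : ℝ) + 1) * (2 * ρ * (4 * N) ^ n) = 2 * (D * ρ) := by rw [hD, hN]; ring
  have hρ6 : ρ ≤ 1 / 6 := by nlinarith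
  calc |u x - (if σ then 1 else -1)|
      = |(u x - p.eval x) + (p.eval x - (if σ then 1 else -1))| := by congr 1; ring
    _ ≤ R + 2 * (D * ρ) := (abs_add_le _ _).trans (add_le_add hx (hpoly.trans hfin.le))
    _ ≤ 1 / 2 := by rw [hρD]; linarith

end LocalRigidity

/-! ### Step functions with values `±1` and boundedly many jumps. -/

section StepFunctions

variable {a b : ℝ} {v : ℝ → ℝ} {K K' : ℕ}

/-- Step functions with values `±1` and at most `K` jumps, all of them located in `[a, b]`. -/
def stepSigns (a b : ℝ) : ℕ → Set (ℝ → ℝ)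
  | 0 => {v | ∃ c : ℝ, (c = 1 ∨ c = -1) ∧ v = fun _ => c}
  | K + 1 => {v | ∃ t ∈ Icc a b, ∃ c : ℝ, (c = 1 ∨ c = -1) ∧ ∃ w ∈ stepSigns a b K,
      v = fun x => if x < t then w x else c}

lemma stepSigns.eq_one_or (hv : v ∈ stepSigns a b K) (x : ℝ) : v x = 1 ∨ v x = -1 := by
  induction K generalizing v with
  | zero => obtain ⟨c, hc, rfl⟩ := hv; exact hc
  | succ K ih =>
    obtain ⟨t, -, c, hc, w, hw, rfl⟩ := hv
    by_cases h : x < t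
    · simpa [h] using ih hw
    · simpa [h] using hc

lemma stepSigns.abs_eq (hv : v ∈ stepSigns a b K) (x : ℝ) : |v x| = 1 := by
  rcases stepSigns.eq_one_or hv x with h | h <;> simp [h]

lemma stepSigns.measurable (hv : v ∈ stepSigns a b K) : Measurable v := by
  induction K generalizing v with
  | zero => obtain ⟨c, hc, rfl⟩ := hv; exact measurable_const
  | succ K ih =>
    obtain ⟨t, -, c, hc, w, hw, rfl⟩ := hv
    exact Measurable.ite measurableSet_Iio (ih hw) measurable_const

/-- A fictitious jump at `a`, with equal values on both sides, is inserted at the innermost level.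
-/
lemma stepSigns_subset_succ (hab : a ≤ b) : stepSigns a b K ⊆ stepSigns a b (K + 1) := by
  induction K with
  | zero =>
    rintro v ⟨c, hc, rfl⟩
    exact ⟨a, left_mem_Icc.2 hab, c, hc, _, ⟨c, hc, rfl⟩, by simp⟩
  | succ K ih =>
    rintro v ⟨t, ht, c, hc, w, hw, rfl⟩
    exact ⟨t, ht, c, hc, w, ih hw, rfl⟩

lemma stepSigns_mono (hab : a ≤ b) (h : K ≤ K') : stepSigns a b K ⊆ stepSigns a b K' :=
  monotone_nat_of_le_succ (f := stepSigns a b) (fun _ => stepSigns_subset_succ hab) h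

lemma stepSigns.integrableOn (hv : v ∈ stepSigns a b K) (I : Set ℝ) (hI : volume I ≠ ⊤) :
    IntegrableOn v I :=
  IntegrableOn.of_bound hI.lt_top (stepSigns.measurable hv).aestronglyMeasurable 1
    (ae_of_all _ fun x => (stepSigns.abs_eq hv x).le)

/-- Each of the at most `K + 1` pieces of constancy contributes an increment of `±φ`, at most `2`.
The endpoints are arbitrary because the induction cuts the interval at the last jump. -/
lemma stepSigns.abs_integral_mul_deriv_le (hv : v ∈ stepSigns a b K) {φ : ℝ → ℝ}
    (hφ : ContDiff ℝ ∞ φ) (hφ1 : ∀ x, |φ x| ≤ 1) {p q : ℝ} (hpq : p ≤ q) :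
    |∫ x in p..q, v x * deriv φ x| ≤ 2 * (K + 1) := by
  have hd : Continuous (deriv φ) := hφ.continuous_deriv (by simp)
  have hconst : ∀ c : ℝ, (c = 1 ∨ c = -1) → ∀ p q, |∫ x in p..q, c * deriv φ x| ≤ 2 := by
    intro c hc p q
    have hc1 : |c| = 1 := by rcases hc with rfl | rfl <;> simp
    rw [intervalIntegral.integral_const_mul, intervalIntegral.integral_deriv_eq_sub
      (fun x _ => (hφ.differentiable (by simp)) x) (hd.intervalIntegrable _ _), abs_mul, hc1,
      one_mul]
    exact (abs_sub _ _).trans (by linarith [hφ1 p, hφ1 q])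
  induction K generalizing v p q with
  | zero =>
    obtain ⟨c, hc, rfl⟩ := hv
    simpa using hconst c hc p q
  | succ K ih =>
    have hint : ∀ p q, IntervalIntegrable (fun x => v x * deriv φ x) volume p q := fun p q =>
      (intervalIntegrable_iff.2 (stepSigns.integrableOn hv _ (by simp))).mul_continuousOn
        hd.continuousOn
    obtain ⟨t, -, c, hc, w, hw, hvw⟩ := hv
    push_cast
    have hleft : ∀ {r}, p ≤ r → r ≤ t → ∫ x in p..r, v x * deriv φ x =
        ∫ x in p..r, w x * deriv φ x := by
      intro r hpr hrt
      rw [← setIntegral_Ioo_eq_intervalIntegral hpr, ← setIntegral_Ioo_eq_intervalIntegral hpr]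
      refine setIntegral_congr_fun measurableSet_Ioo fun x hx => ?_
      simp [hvw, hx.2.trans_le hrt]
    have hright : ∀ {r}, r ≤ q → t ≤ r → ∫ x in r..q, v x * deriv φ x =
        ∫ x in r..q, c * deriv φ x := by
      intro r hrq htr
      rw [← setIntegral_Ioo_eq_intervalIntegral hrq, ← setIntegral_Ioo_eq_intervalIntegral hrq]
      refine setIntegral_congr_fun measurableSet_Ioo fun x hx => ?_
      simp [hvw, not_lt.2 (htr.trans hx.1.le)]
    have hK : (0 : ℝ) ≤ K := K.cast_nonneg
    rcases le_total t p with htp | htp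
    · rw [hright hpq htp]
      exact (hconst c hc p q).trans (by linarith)
    rcases le_total q t with hqt | hqt
    · rw [hleft hpq hqt]
      exact (ih hw hpq).trans (by linarith)
    rw [← intervalIntegral.integral_add_adjacent_intervals (hint p t) (hint t q),
      hleft htp le_rfl, hright hqt le_rfl]
    refine (abs_add_le _ _).trans ?_
    linarith [ih hw htp, hconst c hc t q]

lemma stepSigns.memBVSign (hab : a ≤ b) (hv : v ∈ stepSigns a b K) : MemBVSign (Ioo a b) v := by
  refine ⟨memLp_one_iff_integrable.2 (stepSigns.integrableOn hv _ (by simp)),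
    ae_of_all _ (stepSigns.eq_one_or hv), ?_⟩
  refine lt_of_le_of_lt ?_ (EReal.coe_lt_top (2 * (K + 1)))
  refine iSup₂_le fun φ hφ => EReal.coe_le_coe_iff.2 ?_
  rw [setIntegral_Ioo_eq_intervalIntegral hab]
  exact (le_abs_self _).trans (stepSigns.abs_integral_mul_deriv_le hv hφ.1.1 hφ.2 hab)

lemma exists_subseq_tendsto_sign {c : ℕ → ℝ} (hc : ∀ m, c m = 1 ∨ c m = -1) :
    ∃ c₀ : ℝ, (c₀ = 1 ∨ c₀ = -1) ∧ ∃ s : ℕ → ℕ, StrictMono s ∧ Tendsto (c ∘ s) atTop (𝓝 c₀) := by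
  obtain ⟨c₀, h, s, hs, ht⟩ := (Set.toFinite ({1, -1} : Set ℝ)).isCompact.tendsto_subseq (x := c)
    (fun m => by simpa using hc m)
  exact ⟨c₀, by simpa using h, s, hs, ht⟩

/-- Step functions with a bounded number of jumps are sequentially compact for convergence almost
everywhere. -/
lemma stepSigns.exists_subseq {v : ℕ → ℝ → ℝ} (hv : ∀ m, v m ∈ stepSigns a b K) :
    ∃ w ∈ stepSigns a b K, ∃ s : ℕ → ℕ, StrictMono s ∧
      ∀ᵐ x : ℝ, Tendsto (fun m => v (s m) x) atTop (𝓝 (w x)) := by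
  induction K generalizing v with
  | zero =>
    choose c hc hvc using hv
    obtain ⟨c₀, h, s, hs, ht⟩ := exists_subseq_tendsto_sign hc
    refine ⟨fun _ => c₀, ⟨c₀, h, rfl⟩, s, hs, ae_of_all _ fun x => ?_⟩
    simpa [hvc, Function.comp_def] using ht
  | succ K ih =>
    choose t ht c hc w hw hvw using hv
    obtain ⟨t₀, ht₀, s₁, hs₁, htt⟩ := isCompact_Icc.tendsto_subseq ht
    obtain ⟨c₀, hc₀, s₂, hs₂, hcc⟩ := exists_subseq_tendsto_sign (fun m => hc (s₁ m))
    obtain ⟨w₀, hw₀, s₃, hs₃, hww⟩ := ih (fun m => hw (s₁ (s₂ m)))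
    refine ⟨_, ⟨t₀, ht₀, c₀, hc₀, w₀, hw₀, rfl⟩, fun m => s₁ (s₂ (s₃ m)),
      hs₁.comp (hs₂.comp hs₃), ?_⟩
    have htt' := htt.comp (hs₂.comp hs₃).tendsto_atTop
    have hcc' := hcc.comp hs₃.tendsto_atTop
    -- Away from the limit jump `t₀`, the point `x` eventually stays on one side of the
    -- approximating jumps.
    filter_upwards [hww, Measure.ae_ne volume t₀] with x hx hxt
    rcases lt_or_gt_of_ne hxt with h | h
    · have : ∀ᶠ m in atTop, x < t (s₁ (s₂ (s₃ m))) := htt'.eventually (lt_mem_nhds h)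
      simp only [h, if_true]
      refine hx.congr' ?_
      filter_upwards [this] with m hm
      rw [hvw]; simp [hm]
    · have : ∀ᶠ m in atTop, t (s₁ (s₂ (s₃ m))) < x := htt'.eventually (gt_mem_nhds h)
      simp only [not_lt.2 h.le, if_false]
      refine hcc'.congr' ?_
      filter_upwards [this] with m hm
      rw [hvw]; simp [not_lt.2 hm.le]

/-- The step function with given values on the cells of a grid. -/
lemma exists_stepSigns_of_grid {x s : ℕ → ℝ} (hx : Monotone x) (hs : ∀ i, s i = 1 ∨ s i = -1)
    (j : ℕ) (hxI : ∀ i ≤ j, x i ∈ Icc a b) :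
    ∃ w ∈ stepSigns a b ((Finset.range j).filter fun i => s (i + 1) ≠ s i).card,
      (∀ i < j, ∀ y ∈ Ico (x i) (x (i + 1)), w y = s i) ∧ ∀ y ≥ x j, w y = s j := by
  induction j with
  | zero => exact ⟨fun _ => s 0, ⟨s 0, hs 0, rfl⟩, by simp, by simp⟩
  | succ j ih =>
    obtain ⟨w, hw, h1, h2⟩ := ih fun i hi => hxI i (hi.trans j.le_succ)
    have hle := hx j.le_succ
    rw [Finset.range_add_one, Finset.filter_insert]
    -- Only a change of sign costs a jump, so the number of cells does not enter the count.
    by_cases hj : s (j + 1) = s j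
    · rw [if_neg (by simpa using hj)]
      refine ⟨w, hw, fun i hi y hy => ?_, fun y hy => hj ▸ h2 y (hle.trans hy)⟩
      rcases (Nat.lt_succ_iff_lt_or_eq).1 hi with h | rfl
      · exact h1 i h y hy
      · exact h2 y hy.1
    · rw [if_pos hj, Finset.card_insert_of_notMem (by simp)]
      refine ⟨_, ⟨x (j + 1), hxI _ le_rfl, s (j + 1), hs _, w, hw, rfl⟩, fun i hi y hy => ?_,
        fun y hy => by simp [not_lt.2 hy]⟩
      have hyj : y < x (j + 1) := hy.2.trans_le (hx hi)
      simp only [hyj, if_true]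
      rcases (Nat.lt_succ_iff_lt_or_eq).1 hi with h | rfl
      · exact h1 i h y hy
      · exact h2 y hy.1

end StepFunctions

/-! ### Absorbing the negative term of the energy. -/

section EnergyBound

variable {a b h c : ℝ} {W u : ℝ → ℝ} {n N : ℕ}

lemma MemSobolev.exists_bound (hab : a < b) (hn : 1 ≤ n) (hu : MemSobolev (Ioo a b) n u) :
    ∃ C, ∀ᵐ x ∂(volume.restrict (Ioo a b)), |u x| ≤ C := by
  obtain ⟨m, rfl⟩ : ∃ m, n = m + 1 := ⟨n - 1, by omega⟩
  obtain ⟨p, -, hp⟩ := (hu.isWeakDeriv le_rfl).exists_polynomial hab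
    ((hu.memLp_weakDeriv hab le_rfl).integrable (by norm_num))
  obtain ⟨C, hC⟩ := isCompact_Icc.exists_bound_of_continuousOn
    (s := Icc a b) (f := fun x => p.eval x) p.continuous.continuousOn
  refine ⟨(b - a) ^ m * (∫ t in Ioo a b, |weakDeriv (Ioo a b) (m + 1) u t|) + C, ?_⟩
  filter_upwards [hp, ae_restrict_mem measurableSet_Ioo] with x hx hxI
  calc |u x| = |(u x - p.eval x) + p.eval x| := by congr 1; ring
    _ ≤ _ := (abs_add_le _ _).trans (add_le_add hx (hC x (Ioo_subset_Icc_self hxI)))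

/-- Boundedness of `u` replaces any growth condition on `F`, in particular on `W`. -/
lemma MemSobolev.integrableOn_comp (hab : a < b) (hn : 1 ≤ n) (hu : MemSobolev (Ioo a b) n u)
    {F : ℝ → ℝ} (hF : Continuous F) : IntegrableOn (fun x => F (u x)) (Ioo a b) := by
  obtain ⟨C, hC⟩ := hu.exists_bound hab hn
  obtain ⟨M, hM⟩ := isCompact_Icc.exists_bound_of_continuousOn (s := Icc (-C) C) hF.continuousOn
  refine IntegrableOn.of_bound (by simp)
    (hF.comp_aestronglyMeasurable hu.1.aestronglyMeasurable) M ?_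
  filter_upwards [hC] with x hx
  exact hM _ (abs_le.1 hx)

lemma sum_setIntegral_grid {f : ℝ → ℝ} (hh : 0 < h) (hf : IntegrableOn f (Ioo a (a + N * h))) :
    ∑ i ∈ Finset.range N, ∫ x in Ioo (a + i * h) (a + (i + 1 : ℕ) * h), f x =
      ∫ x in Ioo a (a + N * h), f x := by
  have hmono : Monotone fun i : ℕ => a + i * h := fun i j hij => by
    have : (i : ℝ) ≤ j := by exact_mod_cast hij
    simp only; gcongr
  rw [setIntegral_Ioo_eq_intervalIntegral (by have := hmono (Nat.zero_le N); simpa using this)]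
  have := intervalIntegral.sum_integral_adjacent_intervals (f := f) (μ := volume)
    (a := fun i : ℕ => a + i * h) (n := N) fun k hk => by
      rw [intervalIntegrable_iff_integrableOn_Ioo_of_le (hmono k.le_succ)]
      refine hf.mono_set (Ioo_subset_Ioo ?_ (hmono (Nat.succ_le_of_lt hk)))
      simpa using hmono (Nat.zero_le k)
  simp only [Nat.cast_zero, zero_mul, add_zero] at this
  rw [← this]
  exact Finset.sum_congr rfl fun i _ => setIntegral_Ioo_eq_intervalIntegral (hmono i.le_succ) f

lemma grid_subset (hh : 0 < h) {i j : ℕ} (hj : j ≤ N) :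
    Ioo (a + i * h) (a + j * h) ⊆ Ioo a (a + N * h) := by
  refine Ioo_subset_Ioo (by have : 0 ≤ (i : ℝ) * h := by positivity
                            linarith) ?_
  have : (j : ℝ) ≤ N := by exact_mod_cast hj
  gcongr

/-- The interpolation inequality on the cells of a grid of width `h`, summed up. -/
lemma interpolation_grid (hW : IsDoubleWell W) (hn : 1 ≤ n) (hc : c ∈ interpolationConstants W n)
    (hh : 0 < h) (hab : a < a + N * h) (hu : MemSobolev (Ioo a (a + N * h)) n u) :
    c * ∫ x in Ioo a (a + N * h), weakDeriv (Ioo a (a + N * h)) (n - 1) u x ^ 2 ≤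
      1 / h ^ (2 * n - 2) * (∫ x in Ioo a (a + N * h), W (u x)) +
        h ^ 2 * ∫ x in Ioo a (a + N * h), weakDeriv (Ioo a (a + N * h)) n u x ^ 2 := by
  set I := Ioo a (a + N * h) with hI
  have i1 : IntegrableOn (fun x => weakDeriv I (n - 1) u x ^ 2) I :=
    (hu.memLp_weakDeriv hab (Nat.sub_le n 1)).integrable_sq
  have i2 : IntegrableOn (fun x => weakDeriv I n u x ^ 2) I :=
    (hu.memLp_weakDeriv hab le_rfl).integrable_sq
  have i3 : IntegrableOn (fun x => W (u x)) I := hu.integrableOn_comp hab hn hW.continuous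
  rw [← sum_setIntegral_grid hh i1, ← sum_setIntegral_grid hh i2, ← sum_setIntegral_grid hh i3,
    Finset.mul_sum, Finset.mul_sum, Finset.mul_sum, ← Finset.sum_add_distrib]
  refine Finset.sum_le_sum fun i hi => ?_
  have hs : Ioo (a + i * h) (a + (i + 1 : ℕ) * h) ⊆ I :=
    grid_subset hh (Nat.succ_le_of_lt (Finset.mem_range.1 hi))
  have hl : a + (i + 1 : ℕ) * h - (a + i * h) = h := by push_cast; ring
  have hlt : a + i * h < a + (i + 1 : ℕ) * h := by linarith
  have key := hc _ _ hlt u (hu.mono hs)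
  rw [hl] at key
  have e : ∀ k ≤ n, ∫ x in Ioo (a + i * h) (a + (i + 1 : ℕ) * h),
      weakDeriv (Ioo (a + i * h) (a + (i + 1 : ℕ) * h)) k u x ^ 2 =
        ∫ x in Ioo (a + i * h) (a + (i + 1 : ℕ) * h), weakDeriv I k u x ^ 2 := fun k hk => by
    refine integral_congr_ae ?_
    filter_upwards [hu.weakDeriv_ae_eq hlt hs hk] with x hx
    rw [hx]
  rwa [e _ (Nat.sub_le n 1), e n le_rfl] at key

/-- The energy without its negative term, and with the weak derivative of `u` on `(a, b)`. -/
noncomputable def positiveEnergy (W : ℝ → ℝ) (a b : ℝ) (n : ℕ) (ε : ℝ) (u : ℝ → ℝ) : ℝ :=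
  1 / ε * (∫ x in Ioo a b, W (u x)) +
    ε ^ (2 * n - 1) * ∫ x in Ioo a b, weakDeriv (Ioo a b) n u x ^ 2

/-- Multiplying `interpolation_grid` by `lam / c * ε ^ (2 * n - 3)` bounds the negative term by `κ`
times the positive energy: the potential part gains `(ε / h) ^ (2 * n - 2)`, the derivative part
only needs `h ≤ ε`. -/
lemma positiveEnergy_le {lam ε κ C : ℝ} (hW : IsDoubleWell W) (hn : 2 ≤ n)
    (hc : c ∈ interpolationConstants W n) (hc0 : 0 < c) (hlam : 0 < lam) (hε : 0 < ε)
    (hh : 0 < h) (hhε : h ≤ ε) (hN : 0 < N) (hκ : lam / c * (ε / h) ^ (2 * n - 2) ≤ κ)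
    (hκ1 : κ < 1) (hu : MemSobolev (Ioo a (a + N * h)) n u)
    (hE : energy W (Ioo a (a + N * h)) n lam ε u < (C : ℝ)) :
    positiveEnergy W a (a + N * h) n ε u ≤ C / (1 - κ) := by
  have hab : a < a + N * h := by
    have : 0 < (N : ℝ) * h := by positivity
    linarith
  have hint := interpolation_grid hW (by omega) hc hh hab hu
  unfold positiveEnergy
  set I := Ioo a (a + N * h) with hI
  have i1 : IntegrableOn (fun x => weakDeriv I (n - 1) u x ^ 2) I :=
    (hu.memLp_weakDeriv hab (Nat.sub_le n 1)).integrable_sq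
  have i2 : IntegrableOn (fun x => weakDeriv I n u x ^ 2) I :=
    (hu.memLp_weakDeriv hab le_rfl).integrable_sq
  have i3 : IntegrableOn (fun x => W (u x)) I :=
    hu.integrableOn_comp hab (by omega) hW.continuous
  have j1 := i1.const_mul (lam * ε ^ (2 * n - 3))
  have j2 := i2.const_mul (ε ^ (2 * n - 1))
  have j3 := i3.const_mul (1 / ε)
  have j4 : IntegrableOn (fun x => 1 / ε * W (u x) -
      lam * ε ^ (2 * n - 3) * weakDeriv I (n - 1) u x ^ 2) I := j3.sub j1
  rw [energy, if_pos hu, EReal.coe_lt_coe_iff, integral_add j4 j2, integral_sub j3 j1,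
    integral_const_mul, integral_const_mul, integral_const_mul] at hE
  set A := ∫ x in I, weakDeriv I (n - 1) u x ^ 2
  set B := ∫ x in I, weakDeriv I n u x ^ 2
  set V := ∫ x in I, W (u x)
  have hB : 0 ≤ B := integral_nonneg fun x => sq_nonneg _
  have hV : 0 ≤ V := integral_nonneg fun x => hW.nonneg _
  obtain ⟨m, rfl⟩ : ∃ m, n = m + 2 := ⟨n - 2, by omega⟩
  rw [show 2 * (m + 2) - 3 = 2 * m + 1 by omega] at hE
  rw [show 2 * (m + 2) - 1 = 2 * m + 3 by omega] at hE ⊢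
  rw [show 2 * (m + 2) - 2 = 2 * m + 2 by omega] at hint hκ
  have hr : 1 ≤ (ε / h) ^ (2 * m + 2) := one_le_pow₀ ((one_le_div hh).2 hhε)
  have hq : lam / c ≤ κ := (le_mul_of_one_le_right (by positivity) hr).trans hκ
  have h1 : lam * ε ^ (2 * m + 1) * A ≤
      κ * (1 / ε * V + ε ^ (2 * m + 3) * B) := by
    calc lam * ε ^ (2 * m + 1) * A = lam / c * ε ^ (2 * m + 1) * (c * A) := by field_simp
      _ ≤ lam / c * ε ^ (2 * m + 1) * (1 / h ^ (2 * m + 2) * V + h ^ 2 * B) := by gcongr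
      _ ≤ lam / c * ε ^ (2 * m + 1) * (1 / h ^ (2 * m + 2) * V + ε ^ 2 * B) := by gcongr
      _ = lam / c * (ε / h) ^ (2 * m + 2) * (1 / ε * V) +
          lam / c * (ε ^ (2 * m + 3) * B) := by
        rw [div_pow]; field_simp; ring
      _ ≤ κ * (1 / ε * V) + κ * (ε ^ (2 * m + 3) * B) := by gcongr
      _ = _ := by ring
  rw [le_div_iff₀ (by linarith)]
  nlinarith

end EnergyBound

/-! ### Approximation by step functions at scale `ε`. -/

section Approximation

variable {a h : ℝ} {W : ℝ → ℝ} {N : ℕ}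

/-- The two one-sided bounds miss only `t = 0`, which continuity supplies. -/
lemma IsDoubleWell.exists_coercive (hW : IsDoubleWell W) :
    ∃ L > 0, ∀ t, L * (|t| - 1) ^ 2 ≤ W t := by
  obtain ⟨L, hL, h1, h2⟩ := hW.coercive
  have hcl : IsClosed {t : ℝ | L * (|t| - 1) ^ 2 ≤ W t} :=
    isClosed_le (by fun_prop) hW.continuous
  have hsub : ({0}ᶜ : Set ℝ) ⊆ {t : ℝ | L * (|t| - 1) ^ 2 ≤ W t} := by
    intro t ht
    rcases lt_or_gt_of_ne (mem_compl_singleton_iff.1 ht) with h | h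
    · have := h2 t h
      rw [mem_ofPred_eq, abs_of_neg h]
      rwa [show (-t - 1) ^ 2 = (t + 1) ^ 2 by ring]
    · have := h1 t h
      rwa [mem_ofPred_eq, abs_of_pos h]
  refine ⟨L, hL, fun t => ?_⟩
  have := (dense_compl_singleton (0 : ℝ)).mono hsub
  have huniv := this.closure_eq
  rw [hcl.closure_eq] at huniv
  have ht : t ∈ {t : ℝ | L * (|t| - 1) ^ 2 ≤ W t} := by rw [huniv]; exact mem_univ t
  exact ht

/-- For bad cells, where the sign is arbitrary; on good cells `abs_sub_sign_le_of_near` avoids the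
extra `2`. -/
lemma abs_sub_sign_le {t s : ℝ} (hs : s = 1 ∨ s = -1) : |t - s| ≤ |(|t| - 1)| + 2 := by
  rcases hs with rfl | rfl <;> rcases abs_cases t with ⟨h, _⟩ | ⟨h, _⟩ <;> rw [h] <;>
    rcases abs_cases (t - 1) with ⟨h1, _⟩ | ⟨h1, _⟩ <;>
    rcases abs_cases (-t - 1) with ⟨h2, _⟩ | ⟨h2, _⟩ <;>
    rcases abs_cases (t - -1) with ⟨h3, _⟩ | ⟨h3, _⟩ <;> linarith

lemma abs_sub_sign_le_of_near {t s : ℝ} (hs : s = 1 ∨ s = -1) (h : |t - s| ≤ 1 / 2) :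
    |t - s| ≤ |(|t| - 1)| := by
  have := abs_le.1 h
  rcases hs with rfl | rfl
  · rw [abs_of_pos (by linarith : 0 < t)]
  · rw [abs_of_neg (by linarith : t < 0), ← abs_neg]
    exact le_of_eq (by congr 1; ring)

lemma sign_eq_of_near {t s s' : ℝ} (hs : s = 1 ∨ s = -1) (hs' : s' = 1 ∨ s' = -1)
    (h : |t - s| ≤ 1 / 2) (h' : |t - s'| ≤ 1 / 2) : s = s' := by
  have := abs_le.1 h
  have := abs_le.1 h'
  rcases hs with rfl | rfl <;> rcases hs' with rfl | rfl <;> first | rfl | linarith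

/-- The number of pairs of neighbouring cells carrying more than a given amount of the integral of a
non-negative function is bounded. -/
lemma card_filter_grid_le {e : ℝ → ℝ} {δ C : ℝ} (hh : 0 < h) (hδ : 0 < δ) (he : ∀ x, 0 ≤ e x)
    (hei : IntegrableOn e (Ioo a (a + (N + 1 : ℕ) * h)))
    (hC : ∫ x in Ioo a (a + (N + 1 : ℕ) * h), e x ≤ C) :
    (((Finset.range N).filter fun i : ℕ =>
      δ < ∫ x in Ioo (a + i * h) (a + (i + 2 : ℕ) * h), e x).card : ℝ) ≤ 2 * C / δ := by
  set J : ℕ → ℝ := fun i => ∫ x in Ioo (a + i * h) (a + (i + 1 : ℕ) * h), e x with hJ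
  have hJ0 : ∀ i, 0 ≤ J i := fun i => integral_nonneg he
  have hsum : ∑ i ∈ Finset.range (N + 1), J i ≤ C := (sum_setIntegral_grid hh hei).trans_le hC
  have hmono : Monotone fun i : ℕ => a + i * h := fun i j hij => by
    have : (i : ℝ) ≤ j := by exact_mod_cast hij
    simp only; gcongr
  have hsplit : ∀ i ∈ Finset.range N,
      ∫ x in Ioo (a + i * h) (a + (i + 2 : ℕ) * h), e x = J i + J (i + 1) := by
    intro i hi
    have hi := Finset.mem_range.1 hi
    have hint : ∀ i ≤ N, IntervalIntegrable e volume (a + i * h) (a + (i + 1 : ℕ) * h) := by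
      intro i hi
      rw [intervalIntegrable_iff_integrableOn_Ioo_of_le (hmono i.le_succ)]
      exact hei.mono_set (grid_subset hh (Nat.succ_le_succ hi))
    simp only [hJ]
    rw [setIntegral_Ioo_eq_intervalIntegral (hmono (by omega)),
      setIntegral_Ioo_eq_intervalIntegral (hmono (by omega)),
      setIntegral_Ioo_eq_intervalIntegral (hmono (by omega)),
      intervalIntegral.integral_add_adjacent_intervals (hint i hi.le) (hint (i + 1) hi)]
  -- Every cell lies in at most two windows, hence the factor `2`.
  have hpair : ∑ i ∈ Finset.range N, ∫ x in Ioo (a + i * h) (a + (i + 2 : ℕ) * h), e x ≤ 2 * C := by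
    rw [Finset.sum_congr rfl hsplit, Finset.sum_add_distrib]
    have h1 := Finset.sum_range_succ J N
    have h2 := Finset.sum_range_succ' J N
    linarith [hJ0 N, hJ0 0]
  rw [le_div_iff₀ hδ, ← nsmul_eq_mul]
  refine le_trans ?_ hpair
  refine le_trans (Finset.card_nsmul_le_sum _ _ δ fun i hi => (Finset.mem_filter.1 hi).2.le) ?_
  exact Finset.sum_le_sum_of_subset_of_nonneg (Finset.filter_subset _ _)
    fun i _ _ => integral_nonneg he

/-- A function of bounded positive energy is close in `L¹` to a step function with values `±1`
and a bounded number of jumps. -/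
lemma exists_stepSigns_near (hW : IsDoubleWell W) (a b : ℝ) (n : ℕ) (C : ℝ) :
    ∃ (K : ℕ) (M : ℝ), ∀ (ε h : ℝ) (N : ℕ) (u : ℝ → ℝ), 0 < ε → 0 < h → h ≤ ε → ε ≤ 2 * h →
      0 < N → a + N * h = b → MemSobolev (Ioo a b) (n + 1) u →
      positiveEnergy W a b (n + 1) ε u ≤ C →
      ∃ w ∈ stepSigns a b K, ∫ x in Ioo a b, |u x - w x| ≤ √(M * ε) + M * ε := by
  obtain ⟨L, hL, hWL⟩ := hW.exists_coercive
  obtain ⟨δ₀, hδ₀, hrig⟩ := exists_rigidity n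
  -- The first entry controls the well term, using `ε ≤ 2 * h`; the second controls the derivative
  -- term on a window of length `2 * h ≤ 2 * ε`.
  set δ := min (L * δ₀) (δ₀ / 2 ^ (2 * n + 1)) with hδdef
  have hδ : 0 < δ := lt_min (by positivity) (by positivity)
  set K := ⌈2 * C / δ⌉₊ + 1 with hK
  -- A bad index can cause a jump on either side of its cell, hence `2 * K`. In the maximum, the
  -- first entry serves the Cauchy–Schwarz term, the second the at most `K` bad cells, each costing
  -- an extra `2 * h`.
  refine ⟨2 * K, max ((b - a) * (C / L)) (2 * K), fun ε h N u hε hh hhε hεh hN hb hu hE => ?_⟩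
  set M := max ((b - a) * (C / L)) (2 * K) with hM
  obtain ⟨N, rfl⟩ : ∃ N', N = N' + 1 := ⟨N - 1, by omega⟩
  have hab : a < b := by
    have : 0 < ((N + 1 : ℕ) : ℝ) * h := by positivity
    linarith
  set g := weakDeriv (Ioo a b) (n + 1) u with hg
  have hgL : MemLp g 2 (volume.restrict (Ioo a b)) := hu.memLp_weakDeriv hab le_rfl
  have hgw : IsWeakDeriv (Ioo a b) (n + 1) u g := hu.isWeakDeriv le_rfl
  have iW : IntegrableOn (fun x => W (u x)) (Ioo a b) :=
    hu.integrableOn_comp hab (by omega) hW.continuous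
  have ig : IntegrableOn (fun x => g x ^ 2) (Ioo a b) := hgL.integrable_sq
  have iu : IntegrableOn (fun x => (|u x| - 1) ^ 2) (Ioo a b) :=
    hu.integrableOn_comp hab (by omega) (F := fun t => (|t| - 1) ^ 2) (by fun_prop)
  have iu1 : IntegrableOn (fun x => |(|u x| - 1)|) (Ioo a b) :=
    hu.integrableOn_comp hab (by omega) (F := fun t => |(|t| - 1)|) (by fun_prop)
  set e : ℝ → ℝ := fun x => 1 / ε * W (u x) + ε ^ (2 * n + 1) * g x ^ 2 with he
  have he0 : ∀ x, 0 ≤ e x := fun x => by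
    have := hW.nonneg (u x)
    simp only [he]; positivity
  have hei : IntegrableOn e (Ioo a b) := (iW.const_mul _).add (ig.const_mul _)
  have heE : ∫ x in Ioo a b, e x ≤ C := by
    refine le_trans (le_of_eq ?_) hE
    rw [integral_add (iW.const_mul _) (ig.const_mul _), integral_const_mul, integral_const_mul]
    rfl
  have hWe : ∀ x, (|u x| - 1) ^ 2 ≤ ε / L * e x := fun x => by
    have h1 : 0 ≤ ε ^ (2 * n + 1) * g x ^ 2 := by positivity
    have h2 := hWL (u x)
    calc (|u x| - 1) ^ 2 = 1 / L * (L * (|u x| - 1) ^ 2) := by field_simp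
      _ ≤ 1 / L * W (u x) := by gcongr
      _ = ε / L * (1 / ε * W (u x)) := by field_simp
      _ ≤ ε / L * e x := by
        apply mul_le_mul_of_nonneg_left _ (by positivity)
        simp only [he]; linarith
  have hge : ∀ x, g x ^ 2 ≤ 1 / ε ^ (2 * n + 1) * e x := fun x => by
    have h1 : 0 ≤ 1 / ε * W (u x) := mul_nonneg (by positivity) (hW.nonneg _)
    calc g x ^ 2 = 1 / ε ^ (2 * n + 1) * (ε ^ (2 * n + 1) * g x ^ 2) := by field_simp
      _ ≤ _ := by
        apply mul_le_mul_of_nonneg_left _ (by positivity)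
        simp only [he]; linarith
  set x : ℕ → ℝ := fun i => a + i * h with hx
  have hxmono : StrictMono x := fun i j hij => by
    have : (i : ℝ) < j := by exact_mod_cast hij
    simp only [hx]; gcongr
  have hsub : ∀ {i j : ℕ}, j ≤ N + 1 → Ioo (x i) (x j) ⊆ Ioo a b := fun {i j} hj => by
    rw [← hb]; exact grid_subset hh hj
  have hgood : ∀ i < N, ∫ y in Ioo (x i) (x (i + 2)), e y ≤ δ →
      ∃ s : ℝ, (s = 1 ∨ s = -1) ∧
        ∀ᵐ y ∂(volume.restrict (Ioo (x i) (x (i + 2)))), |u y - s| ≤ 1 / 2 := by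
    intro i hi hd
    have hs : Ioo (x i) (x (i + 2)) ⊆ Ioo a b := hsub (by omega)
    have hl : x (i + 2) - x i = 2 * h := by simp only [hx]; push_cast; ring
    have hei' := hei.mono_set hs
    refine hrig _ _ u g (hxmono (by omega)) (hgw.mono hs)
      (hgL.mono_measure (Measure.restrict_mono hs le_rfl)) (iu.mono_set hs) ?_ ?_
    · calc ∫ y in Ioo (x i) (x (i + 2)), (|u y| - 1) ^ 2
          ≤ ∫ y in Ioo (x i) (x (i + 2)), ε / L * e y :=
            setIntegral_mono (iu.mono_set hs) (hei'.const_mul _) hWe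
        _ = ε / L * ∫ y in Ioo (x i) (x (i + 2)), e y := integral_const_mul _ _
        _ ≤ ε / L * (L * δ₀) := by gcongr; exact hd.trans (min_le_left _ _)
        _ = ε * δ₀ := by field_simp
        _ ≤ _ := by rw [hl]; gcongr
    · rw [hl]
      calc (2 * h) ^ (2 * n + 1) * ∫ y in Ioo (x i) (x (i + 2)), g y ^ 2
          ≤ (2 * ε) ^ (2 * n + 1) * ∫ y in Ioo (x i) (x (i + 2)), g y ^ 2 := by
            gcongr
        _ ≤ (2 * ε) ^ (2 * n + 1) *
            ∫ y in Ioo (x i) (x (i + 2)), 1 / ε ^ (2 * n + 1) * e y := by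
            exact mul_le_mul_of_nonneg_left
              (setIntegral_mono (ig.mono_set hs) (hei'.const_mul _) hge) (by positivity)
        _ = 2 ^ (2 * n + 1) * ∫ y in Ioo (x i) (x (i + 2)), e y := by
            rw [integral_const_mul, mul_pow]; field_simp
        _ ≤ 2 ^ (2 * n + 1) * (δ₀ / 2 ^ (2 * n + 1)) := by
            gcongr; exact hd.trans (min_le_right _ _)
        _ = δ₀ := by field_simp
  classical
  have hsign : ∀ i : ℕ, ∃ s : ℝ, (s = 1 ∨ s = -1) ∧
      (i < N ∧ ∫ y in Ioo (x i) (x (i + 2)), e y ≤ δ →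
        ∀ᵐ y ∂(volume.restrict (Ioo (x i) (x (i + 2)))), |u y - s| ≤ 1 / 2) := by
    intro i
    by_cases hi : i < N ∧ ∫ y in Ioo (x i) (x (i + 2)), e y ≤ δ
    · obtain ⟨s, h1, h2⟩ := hgood i hi.1 hi.2
      exact ⟨s, h1, fun _ => h2⟩
    · exact ⟨1, Or.inl rfl, fun h => absurd h hi⟩
  choose s hs hsu using hsign
  -- The last cell, of index `N`, starts no window and is counted as bad.
  set B : Finset ℕ := insert N ((Finset.range N).filter fun i : ℕ =>
      δ < ∫ y in Ioo (x i) (x (i + 2)), e y) with hB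
  have hBK : B.card ≤ K := by
    refine (Finset.card_insert_le _ _).trans (Nat.succ_le_succ ?_)
    have := card_filter_grid_le (C := C) hh hδ he0 (hb ▸ hei) (hb ▸ heE)
    exact Nat.cast_le.1 (this.trans (Nat.le_ceil _))
  have hnotB : ∀ i ≤ N, i ∉ B → i < N ∧ ∫ y in Ioo (x i) (x (i + 2)), e y ≤ δ := by
    intro i hi hiB
    rw [hB, Finset.mem_insert, Finset.mem_filter, Finset.mem_range, not_or, not_and, not_lt] at hiB
    have hiN : i < N := lt_of_le_of_ne hi hiB.1
    exact ⟨hiN, hiB.2 hiN⟩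
  have hcard : ((Finset.range N).filter fun i => s (i + 1) ≠ s i).card ≤ 2 * K := by
    -- If `i` and `i + 1` are both good, their windows share the cell `i + 1`, where `u` is within
    -- `1/2` of both signs, so the signs agree.
    have hss : ((Finset.range N).filter fun i => s (i + 1) ≠ s i) ⊆ B ∪ B.image (fun i => i - 1) := by
      intro i hi
      obtain ⟨hiN, hne⟩ := Finset.mem_filter.1 hi
      have hiN := Finset.mem_range.1 hiN
      by_contra hcon
      rw [Finset.mem_union, not_or] at hcon
      have hi1 : i + 1 ∉ B := fun h => hcon.2 (Finset.mem_image.2 ⟨i + 1, h, rfl⟩)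
      have g1 := hsu i (hnotB i hiN.le hcon.1)
      have g2 := hsu (i + 1) (hnotB (i + 1) hiN hi1)
      have o1 : Ioo (x (i + 1)) (x (i + 2)) ⊆ Ioo (x i) (x (i + 2)) :=
        Ioo_subset_Ioo_left (hxmono.monotone (by omega))
      have o2 : Ioo (x (i + 1)) (x (i + 2)) ⊆ Ioo (x (i + 1)) (x (i + 1 + 2)) :=
        Ioo_subset_Ioo_right (hxmono.monotone (by omega))
      have g3 := (ae_restrict_of_ae_restrict_of_subset o1 g1).and
        (ae_restrict_of_ae_restrict_of_subset o2 g2)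
      have : (ae (volume.restrict (Ioo (x (i + 1)) (x (i + 2))))).NeBot := by
        rw [ae_neBot, Ne, Measure.restrict_eq_zero, Real.volume_Ioo]
        simpa using hxmono (by omega : i + 1 < i + 2)
      obtain ⟨y, hy1, hy2⟩ := g3.exists
      exact hne (sign_eq_of_near (hs _) (hs _) hy2 hy1)
    refine (Finset.card_le_card hss).trans ((Finset.card_union_le _ _).trans ?_)
    have := Finset.card_image_le (s := B) (f := fun i => i - 1)
    omega
  have hx0 : x 0 = a := by simp [hx]
  have hxN : x (N + 1) = b := hb
  obtain ⟨w, hw, hw1, hw2⟩ := exists_stepSigns_of_grid (a := a) (b := b) hxmono.monotone hs N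
    fun i hi => ⟨hx0 ▸ hxmono.monotone (Nat.zero_le i), hxN ▸ hxmono.monotone (by omega)⟩
  refine ⟨w, stepSigns_mono hab.le hcard hw, ?_⟩
  have hwval : ∀ i ≤ N, ∀ y ∈ Ioo (x i) (x (i + 1)), w y = s i := by
    intro i hi y hy
    rcases hi.lt_or_eq with h | rfl
    · exact hw1 i h y (Ioo_subset_Ico_self hy)
    · exact hw2 y hy.1.le
  have iuw : IntegrableOn (fun y => |u y - w y|) (Ioo a b) :=
    ((hu.1.integrable (by norm_num)).sub (stepSigns.integrableOn hw _ (by simp))).abs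
  have hcell : ∀ i ∈ Finset.range (N + 1), ∫ y in Ioo (x i) (x (i + 1)), |u y - w y| ≤
      (∫ y in Ioo (x i) (x (i + 1)), |(|u y| - 1)|) + (if i ∈ B then 2 * h else 0) := by
    intro i hi
    have hiN : i ≤ N := Nat.lt_succ_iff.1 (Finset.mem_range.1 hi)
    have hsi : Ioo (x i) (x (i + 1)) ⊆ Ioo a b := hsub (by omega)
    have hle : x i ≤ x (i + 1) := hxmono.monotone i.le_succ
    have hl : x (i + 1) - x i = h := by simp only [hx]; push_cast; ring
    split_ifs with hiB
    · calc ∫ y in Ioo (x i) (x (i + 1)), |u y - w y|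
          ≤ ∫ y in Ioo (x i) (x (i + 1)), (|(|u y| - 1)| + 2) :=
            setIntegral_mono_on (iuw.mono_set hsi)
              ((iu1.mono_set hsi).add (integrableOn_const (by simp))) measurableSet_Ioo
              fun y hy => by rw [hwval i hiN y hy]; exact abs_sub_sign_le (hs i)
        _ = _ := by
            rw [integral_add (iu1.mono_set hsi) (integrableOn_const (by simp))]
            simp only [integral_const, MeasurableSet.univ, measureReal_restrict_apply, univ_inter,
              Real.volume_real_Ioo_of_le hle, smul_eq_mul, hl]
            ring
    · rw [add_zero]
      refine integral_mono_ae (iuw.mono_set hsi) (iu1.mono_set hsi) ?_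
      have h1 := hsu i (hnotB i hiN hiB)
      have o1 : Ioo (x i) (x (i + 1)) ⊆ Ioo (x i) (x (i + 2)) :=
        Ioo_subset_Ioo_right (hxmono.monotone (by omega))
      filter_upwards [ae_restrict_of_ae_restrict_of_subset o1 h1,
        ae_restrict_mem measurableSet_Ioo] with y hy hyI
      rw [hwval i hiN y hyI]
      exact abs_sub_sign_le_of_near (hs i) hy
  have hsq : (∫ y in Ioo a b, |(|u y| - 1)|) ≤ √(M * ε) := by
    apply Real.le_sqrt_of_sq_le
    have hm : MemLp (fun y => |u y| - 1) 2 (volume.restrict (Ioo a b)) :=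
      (memLp_two_iff_integrable_sq ((by fun_prop : Continuous fun t : ℝ => |t| - 1)
        |>.comp_aestronglyMeasurable hu.1.aestronglyMeasurable)).2 iu
    have hba : 0 < b - a := sub_pos.2 hab
    calc (∫ y in Ioo a b, |(|u y| - 1)|) ^ 2 ≤ (b - a) * ∫ y in Ioo a b, (|u y| - 1) ^ 2 :=
          sq_integral_abs_le hab hm
      _ ≤ (b - a) * ∫ y in Ioo a b, ε / L * e y := by
          exact mul_le_mul_of_nonneg_left (setIntegral_mono iu (hei.const_mul _) hWe) hba.le
      _ ≤ (b - a) * (ε / L * C) := by rw [integral_const_mul]; gcongr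
      _ = (b - a) * (C / L) * ε := by ring
      _ ≤ M * ε := by gcongr; exact le_max_left _ _
  have g1 := sum_setIntegral_grid hh (hb ▸ iuw)
  have g2 := sum_setIntegral_grid hh (hb ▸ iu1)
  rw [hb] at g1 g2
  rw [← g1]
  refine (Finset.sum_le_sum hcell).trans ?_
  rw [Finset.sum_add_distrib]
  refine add_le_add (g2.trans_le hsq) ?_
  rw [← Finset.sum_filter, Finset.sum_const, nsmul_eq_mul]
  have hB2 : (((Finset.range (N + 1)).filter fun i => i ∈ B).card : ℝ) ≤ K := by
    refine Nat.cast_le.2 (le_trans (Finset.card_le_card fun i hi => ?_) hBK)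
    exact (Finset.mem_filter.1 hi).2
  calc (((Finset.range (N + 1)).filter fun i => i ∈ B).card : ℝ) * (2 * h) ≤ K * (2 * ε) := by
        gcongr
    _ = 2 * K * ε := by ring
    _ ≤ M * ε := by gcongr; exact le_max_right _ _

end Approximation

/-! ### Choice of the grid and passage to the limit. -/

section Compactness

variable {a b c : ℝ} {W : ℝ → ℝ} {n : ℕ}

/-- A grid of `⌈(b - a) / ε⌉₊` cells has width comparable to `ε`; a bound on the energy gives a bound
on the positive energy. -/
lemma eventually_grid_positiveEnergy_le {lam : ℝ} (hW : IsDoubleWell W) (hn : 2 ≤ n)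
    (hc : c ∈ interpolationConstants W n) (hlam : 0 < lam) (hlc : lam < c) (hab : a < b)
    {ε : ℕ → ℝ} (hε_pos : ∀ m, 0 < ε m) (hε : Tendsto ε atTop (𝓝 0)) {u : ℕ → ℝ → ℝ}
    (hu : ∀ m, MemSobolev (Ioo a b) n (u m)) {C : ℝ}
    (hE : ∀ᶠ m in atTop, energy W (Ioo a b) n lam (ε m) (u m) < (C : ℝ)) :
    ∃ C' : ℝ, ∀ᶠ m in atTop, ∃ (h : ℝ) (N : ℕ), 0 < h ∧ h ≤ ε m ∧ ε m ≤ 2 * h ∧ 0 < N ∧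
      a + N * h = b ∧ positiveEnergy W a b n (ε m) (u m) ≤ C' := by
  have hc0 : 0 < c := hlam.trans hlc
  have hba : 0 < b - a := sub_pos.2 hab
  have hlc1 : lam / c < 1 := (div_lt_one hc0).2 hlc
  -- The gap between `lam / c` and `κ` leaves room for `(ε / h) ^ (2 * n - 2)`, which tends to `1`.
  obtain ⟨κ, hκ, hκ1⟩ := exists_between hlc1
  refine ⟨C / (1 - κ), ?_⟩
  have hx : Tendsto (fun m => (b - a) / ε m) atTop atTop := by
    have h0 : Tendsto ε atTop (𝓝[>] 0) :=
      tendsto_nhdsWithin_iff.2 ⟨hε, Eventually.of_forall hε_pos⟩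
    exact (tendsto_inv_nhdsGT_zero.comp h0).const_mul_atTop hba
  -- This quotient is `ε / h` for `h = (b - a) / N` with `N` the ceiling.
  have hr : Tendsto (fun m => (⌈(b - a) / ε m⌉₊ : ℝ) / ((b - a) / ε m)) atTop (𝓝 1) :=
    (tendsto_nat_ceil_div_atTop (R := ℝ)).comp hx
  have hr' : Tendsto (fun m => lam / c * ((⌈(b - a) / ε m⌉₊ : ℝ) / ((b - a) / ε m)) ^ (2 * n - 2))
      atTop (𝓝 (lam / c)) := by
    simpa using (hr.pow (2 * n - 2)).const_mul (lam / c)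
  filter_upwards [hE, hr.eventually (gt_mem_nhds one_lt_two), hr'.eventually (gt_mem_nhds hκ)]
    with m hm h2 h3
  have hεm := hε_pos m
  have hx0 : 0 < (b - a) / ε m := by positivity
  set N := ⌈(b - a) / ε m⌉₊ with hN
  have hN0 : 0 < N := Nat.ceil_pos.2 hx0
  have hN0' : (0 : ℝ) < N := by exact_mod_cast hN0
  have hNx : (b - a) / ε m ≤ N := Nat.le_ceil _
  have hb : a + N * ((b - a) / N) = b := by field_simp; ring
  have hratio : ε m / ((b - a) / N) = (N : ℝ) / ((b - a) / ε m) := by field_simp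
  have hh : (0 : ℝ) < (b - a) / N := by positivity
  have hhε : (b - a) / N ≤ ε m := by
    rw [div_le_iff₀ hεm] at hNx
    rw [div_le_iff₀ hN0']
    linarith
  refine ⟨(b - a) / N, N, hh, hhε, ?_, hN0, hb, ?_⟩
  · rw [← hratio, div_lt_iff₀ hh] at h2
    exact h2.le
  · rw [← hratio] at h3
    have key := positiveEnergy_le (a := a) (N := N) (h := (b - a) / N) (u := u m) (C := C) hW hn hc
      hc0 hlam hεm hh hhε hN0 h3.le hκ1
    rw [hb] at key
    exact key (hu m) hm

lemma stepSigns.tendsto_integral_abs_sub {K : ℕ} {w : ℕ → ℝ → ℝ} {v : ℝ → ℝ}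
    (hw : ∀ m, w m ∈ stepSigns a b K) (hv : v ∈ stepSigns a b K)
    (h : ∀ᵐ x : ℝ, Tendsto (fun m => w m x) atTop (𝓝 (v x))) :
    Tendsto (fun m => ∫ x in Ioo a b, |w m x - v x|) atTop (𝓝 0) := by
  have := tendsto_integral_of_dominated_convergence (μ := volume.restrict (Ioo a b))
    (F := fun m x => |w m x - v x|) (f := fun _ => 0) (fun _ => 2)
    (fun m => ((stepSigns.measurable (hw m)).sub (stepSigns.measurable hv)).abs.aestronglyMeasurable)
    (integrableOn_const (by simp))
    (fun m => ae_of_all _ fun x => by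
      rw [Real.norm_eq_abs, abs_abs]
      refine (abs_sub _ _).trans ?_
      rw [stepSigns.abs_eq (hw m), stepSigns.abs_eq hv]
      norm_num)
    (by
      filter_upwards [ae_restrict_of_ae h] with x hx
      simpa using (hx.sub_const (v x)).abs)
  simpa using this

lemma eLpNorm_one_eq_ofReal {f : ℝ → ℝ} (hf : IntegrableOn f (Ioo a b)) :
    eLpNorm f 1 (volume.restrict (Ioo a b)) = ENNReal.ofReal (∫ x in Ioo a b, |f x|) := by
  rw [eLpNorm_one_eq_lintegral_enorm, ← ofReal_integral_norm_eq_lintegral_enorm hf]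
  rfl

end Compactness
end HigherOrderPhase

open HigherOrderPhase in
theorem theorem2 (n : ℕ) (hn : 2 ≤ n)
    (W : ℝ → ℝ) (hW : HigherOrderPhase.IsDoubleWell W)
    (lam : ℝ) (hlam_pos : 0 < lam) (hlam : lam < HigherOrderPhase.criticalParameter W n)
    (a b : ℝ) (hab : a < b)
    (ε : ℕ → ℝ) (hε_pos : ∀ m, 0 < ε m) (hε : Tendsto ε atTop (𝓝 0))
    (u : ℕ → ℝ → ℝ) (hu : ∀ m, HigherOrderPhase.MemSobolev (Ioo a b) n (u m))
    (hG : limsup (fun m => HigherOrderPhase.energy W (Ioo a b) n lam (ε m) (u m)) atTop < ⊤) :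
    ∃ v : ℝ → ℝ, HigherOrderPhase.MemBVSign (Ioo a b) v ∧
      ∃ s : ℕ → ℕ, StrictMono s ∧
        Tendsto (fun m => eLpNorm (u (s m) - v) 1 (volume.restrict (Ioo a b))) atTop (𝓝 0) := by
  -- The supremum of the empty set is `0` by convention, which `0 < lam` excludes.
  have hne : (interpolationConstants W n).Nonempty := by
    by_contra h
    rw [not_nonempty_iff_eq_empty] at h
    rw [criticalParameter, h, Real.sSup_empty] at hlam
    linarith
  obtain ⟨c, hc, hlc⟩ := exists_lt_of_lt_csSup hne hlam
  obtain ⟨C, hGC, -⟩ := EReal.lt_iff_exists_real_btwn.1 hG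
  obtain ⟨C', hC'⟩ := eventually_grid_positiveEnergy_le hW hn hc hlam_pos hlc hab hε_pos hε hu
    (eventually_lt_of_limsup_lt hGC)
  obtain ⟨m₀, hm₀⟩ := eventually_atTop.1 hC'
  obtain ⟨k, rfl⟩ : ∃ k, n = k + 1 := ⟨n - 1, by omega⟩
  obtain ⟨K, M, hKM⟩ := exists_stepSigns_near hW a b k C'
  -- The energy bound holds only from `m₀` on, so the sequence is shifted.
  have hnear : ∀ m, ∃ w ∈ stepSigns a b K, ∫ x in Ioo a b, |u (m + m₀) x - w x| ≤
      √(M * ε (m + m₀)) + M * ε (m + m₀) := by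
    intro m
    obtain ⟨h, N, h1, h2, h3, h4, h5, h6⟩ := hm₀ (m + m₀) (Nat.le_add_left _ _)
    exact hKM _ h N _ (hε_pos _) h1 h2 h3 h4 h5 (hu _) h6
  choose w hw hwu using hnear
  obtain ⟨v, hv, s, hs, hsv⟩ := stepSigns.exists_subseq hw
  refine ⟨v, stepSigns.memBVSign hab.le hv, fun m => s m + m₀,
    fun i j hij => Nat.add_lt_add_right (hs hij) _, ?_⟩
  have iu : ∀ m, IntegrableOn (u m) (Ioo a b) := fun m => (hu m).1.integrable (by norm_num)
  have iv : IntegrableOn v (Ioo a b) := stepSigns.integrableOn hv _ (by simp)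
  have iw : ∀ m, IntegrableOn (w m) (Ioo a b) := fun m => stepSigns.integrableOn (hw m) _ (by simp)
  have hεs : Tendsto (fun m => M * ε (s m + m₀)) atTop (𝓝 0) := by
    simpa using (hε.comp ((tendsto_add_atTop_nat m₀).comp hs.tendsto_atTop)).const_mul M
  have hlim : Tendsto (fun m => √(M * ε (s m + m₀)) + M * ε (s m + m₀) +
      ∫ x in Ioo a b, |w (s m) x - v x|) atTop (𝓝 0) := by
    simpa using (hεs.sqrt.add hεs).add
      (stepSigns.tendsto_integral_abs_sub (fun m => hw (s m)) hv hsv)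
  have hle : ∀ m, ∫ x in Ioo a b, |u (s m + m₀) x - v x| ≤ √(M * ε (s m + m₀)) +
      M * ε (s m + m₀) + ∫ x in Ioo a b, |w (s m) x - v x| := by
    intro m
    have i1 : IntegrableOn (fun x => |u (s m + m₀) x - w (s m) x|) (Ioo a b) :=
      ((iu _).sub (iw _)).abs
    have i2 : IntegrableOn (fun x => |w (s m) x - v x|) (Ioo a b) := ((iw _).sub iv).abs
    refine le_trans ?_ (add_le_add_left (hwu (s m)) _)
    rw [← integral_add i1 i2]
    exact setIntegral_mono ((iu _).sub iv).abs (i1.add i2) fun x => abs_sub_le _ _ _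
  have hreal : Tendsto (fun m => ∫ x in Ioo a b, |u (s m + m₀) x - v x|) atTop (𝓝 0) :=
    squeeze_zero (fun m => integral_nonneg fun _ => abs_nonneg _) hle hlim
  have := ENNReal.tendsto_ofReal hreal
  rw [ENNReal.ofReal_zero] at this
  refine this.congr fun m => ?_
  rw [eLpNorm_one_eq_ofReal ((iu _).sub iv)]
  rfl
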